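/- **Setting.** Let $(E,d)$ be a non-compact metric space in which every closed ball is compact, with its Borel $\sigma$-field, and fix $x_0\in E$. Let $(\vartheta_n)_{n\ge1}$ be i.i.d. random variables with values in a measurable space $G$, and let $F:E\times G\to E$ be measurable with $F(\cdot,g)$ Lipschitz continuous for every $g\in G$. The iterative Lipschitz model $X_n=F(X_{n-1},\vartheta_n)$ has transition kernel $Qf(x)=\mathbb E[f(F(x,\vartheta_1))]$. Let $\pi$ be a stationary distribution of $Q$, and set $$\mathcal C=\sup_{x\ne y}\frac{d(F(x,\vartheta_1),F(y,\vartheta_1))}{d(x,y)},\qquad \mathcal M=1+\mathcal C+d(F(x_0,\vartheta_1),x_0).$$ Let $\xi:E\to\mathbb R^d$ satisfy, for some $S,s\ge0$, condition $(L)_s$: $$|\xi(x)-\xi(y)|\le S\,d(x,y)\,[1+d(x,x_0)+d(y,x_0)]^s\qquad(x,y\in E),$$ and, for $t\in\mathbb R^d$, let $Q(t)(x,dy)=e^{i\langle t,\xi(y)\rangle}Q(x,dy)$. For $0<\alpha\le1$ and $0<\beta\le\gamma$ put $p(x)=1+d(x,x_0)$ and $\Delta_{\alpha,\beta,\gamma}(x,y)=p(x)^{\alpha\gamma}p(y)^{\alpha\beta}+p(x)^{\alpha\beta}p(y)^{\alpha\gamma}$.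 Let $\mathcal B_{\alpha,\beta,\gamma}$ be the space of all $f:E\to\mathbb C$ with $$m_{\alpha,\beta,\gamma}(f)=\sup_{x\ne y}\frac{|f(x)-f(y)|}{d(x,y)^\alpha\Delta_{\alpha,\beta,\gamma}(x,y)}<\infty,\qquad\text{with norm}\qquad \|f\|_{\alpha,\beta,\gamma}=m_{\alpha,\beta,\gamma}(f)+\sup_{x\in E}\frac{|f(x)|}{p(x)^{\alpha(\gamma+1)}}.$$ **Hypothesis $\mathcal C(m)$.** Write $\mathcal B\hookrightarrow\mathcal B'$ if $\mathcal B\subset\mathcal B'$ with continuous inclusion, and $\mathcal L(\mathcal B,\mathcal B')$ for the bounded linear operators with the operator norm ($\mathcal L(\mathcal B)$ if $\mathcal B'=\mathcal B$). All spaces $\mathcal B$ below are Banach spaces of $\pi$-integrable functions containing the constant $1$, with $\mathcal B\hookrightarrow\mathbb L^1(\pi)$. Write $Q(\cdot)\in\mathcal C^j(V,\mathcal B,\mathcal B')$ if $t\mapsto Q(t)$ is $j$ times continuously differentiable from the open set $V\subset\mathbb R^d$ to $\mathcal L(\mathcal B,\mathcal B')$. Condition (K) holds on $\mathcal B$ if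 $Q\in\mathcal L(\mathcal B)$ and $\|Q^n-\Pi\|_{\mathcal B}\to0$, where $\Pi f=\pi(f)1$, and there is a neighbourhood $O$ of $0$ in $\mathbb R^d$ such that, for each $t\in O$, $Q(t)\in\mathcal L(\mathcal B)\cap\mathcal L(\mathbb L^1(\pi))$ and $\lim_{h\to0}\|Q(t+h)-Q(t)\|_{\mathcal B,\mathbb L^1(\pi)}=0$, and such that there are $\kappa_1\in[0,1)$ and $c>0$ with $\|Q(t)^nf\|_{\mathcal B}\le c\,\kappa_1^n\|f\|_{\mathcal B}+c\,\pi(|f|)$ for all $n\ge1$, $f\in\mathcal B$, $t\in O$. For $m\ge1$, Hypothesis $\mathcal C(m)$ holds with $\mathcal B,\widetilde{\mathcal B}$ if there are a set $I\subset\mathbb R$, spaces $(\mathcal B_\theta)_{\theta\in I}$ with $\mathcal B_\theta\hookrightarrow\widetilde{\mathcal B}$ for all $\theta\in I$, and maps $T_0,T_1:I\to\mathbb R$ such that every $\theta\in I$ has an open neighbourhood $V_\theta$ of $0$ in $\mathbb R^d$ with, for $j=1,\dots,m$: * (0) if $T_0\theta\in I$ then $\mathcal B_\theta\hookrightarrow\mathcal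 B_{T_0\theta}$, and if $T_1\theta\in I$ then $\mathcal B_\theta\hookrightarrow\mathcal B_{T_1\theta}$; * (1) if $T_0\theta\in I$ then $Q(\cdot)\in\mathcal C^0(V_\theta,\mathcal B_\theta,\mathcal B_{T_0\theta})$; * (2) if $\theta_j:=T_1(T_0T_1)^{j-1}\theta\in I$ then $Q(\cdot)\in\mathcal C^j(V_\theta,\mathcal B_\theta,\mathcal B_{\theta_j})$; * (3) condition (K) holds on $\mathcal B_\theta$; and (4) there is $a$ with $(T_0T_1)^kT_0a\in I$ and $(T_1T_0)^ka\in I$ for $k=0,\dots,m$, $\mathcal B=\mathcal B_a$ and $\widetilde{\mathcal B}=\mathcal B_{(T_0T_1)^mT_0a}$. **Proposition 11.7.** Let $m\ge1$ be an integer, $0<\alpha\le1$, $s+1\le\beta\le\gamma$ and $\gamma'>\gamma+\frac{m(s+1)}{\alpha}$. If $$\mathbb E\big[\mathcal M^{\alpha(\gamma'+1)}+\mathcal C^\alpha\mathcal M^{\alpha(\gamma'+\beta)}\big]<\infty\qquad\text{and}\qquad\mathbb E\big[\mathcal C^\alpha\max\{\mathcal C,1\}^{\alpha(\gamma'+\beta)}\big]<1,$$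 then Hypothesis $\mathcal C(m)$ holds with $\mathcal B=\mathcal B_{\alpha,\beta,\gamma}$ and $\widetilde{\mathcal B}=\mathcal B_{\alpha,\beta,\gamma'}$. -/

import Mathlib

open MeasureTheory ProbabilityTheory Filter Topology

noncomputable section

namespace SpectralMarkov

universe u v

/-! ### Normed spaces of functions -/

/-- A complex normed space whose elements are (identified with) functions `E → ℂ`. -/
structure FunSpace (E : Type u) where
  /-- the underlying type -/
  V : Type u
  [normedGroup : NormedAddCommGroup V]
  [normedSpace : NormedSpace ℂ V]
  /-- the function on `E` represented by an element -/
  toFun : V →ₗ[ℂ] (E → ℂ)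
  injective_toFun : Function.Injective toFun

attribute [instance] FunSpace.normedGroup FunSpace.normedSpace

/-- `B ↪ B'`: as sets of functions `B ⊆ B'`, and the inclusion is continuous. -/
def FunSpace.Embeds {E : Type u} (B B' : FunSpace E) : Prop :=
  ∃ J : B.V →L[ℂ] B'.V, ∀ f : B.V, B'.toFun (J f) = B.toFun f

/-- The standing assumptions on a space `B` with respect to the stationary law `π`:
`B` is a Banach space of `π`-integrable functions, it contains the constant function `1`,
and `B ↪ 𝕃¹(π)`. -/
structure FunSpace.IsAdmissible {E : Type u} [MeasurableSpace E] (B : FunSpace E)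
    (π : Measure E) : Prop where
  complete : CompleteSpace B.V
  measurable : ∀ f : B.V, Measurable (B.toFun f)
  integrable : ∀ f : B.V, Integrable (B.toFun f) π
  one_mem : ∃ e : B.V, B.toFun e = fun _ => 1
  embeds_L1 : ∃ c : ℝ, ∀ f : B.V, ∫ x, ‖B.toFun f x‖ ∂π ≤ c * ‖f‖

section Operators

variable {E : Type u} [MeasurableSpace E] {d : ℕ}

/-- The integrand `e^{i⟨t, ξ(y)⟩} f(y)`. -/
def twist (ξ : E → EuclideanSpace ℝ (Fin d)) (t : EuclideanSpace ℝ (Fin d)) (f : E → ℂ)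
    (y : E) : ℂ :=
  Complex.exp (((inner ℝ t (ξ y) : ℝ) : ℂ) * Complex.I) * f y

/-- The action of the Fourier kernel `Q(t)(x, dy) = e^{i⟨t, ξ(y)⟩} Q(x, dy)` on functions. -/
def fourierAct (Q : Kernel E E) (ξ : E → EuclideanSpace ℝ (Fin d))
    (t : EuclideanSpace ℝ (Fin d)) (f : E → ℂ) (x : E) : ℂ :=
  ∫ y, twist ξ t f y ∂(Q x)

/-- `T` is the Fourier kernel `Q(t)`, seen as an element of `𝓛(B, B')`. -/
def IsFourierOp (Q : Kernel E E) (ξ : E → EuclideanSpace ℝ (Fin d))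
    (t : EuclideanSpace ℝ (Fin d)) (B B' : FunSpace E) (T : B.V →L[ℂ] B'.V) : Prop :=
  ∀ (f : B.V) (x : E), Integrable (twist ξ t (B.toFun f)) (Q x) ∧
    B'.toFun (T f) x = fourierAct Q ξ t (B.toFun f) x

/-- `T` is the Fourier kernel `Q(t)`, seen as an element of `𝓛(𝕃¹(π))`. -/
def IsFourierOpL1 (Q : Kernel E E) (ξ : E → EuclideanSpace ℝ (Fin d)) (π : Measure E)
    (t : EuclideanSpace ℝ (Fin d)) (T : Lp ℂ 1 π →L[ℂ] Lp ℂ 1 π) : Prop :=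
  ∀ u : Lp ℂ 1 π, T u =ᵐ[π] fourierAct Q ξ t u

/-- `Q(·) ∈ 𝒞^j(O, B, B')` for an open set `O`: for `t ∈ O`, `Q(t)` is a bounded operator from
`B` to `B'`, and `t ↦ Q(t)` is `j` times continuously differentiable on `O` for the
operator norm. -/
def FourierContDiff (Q : Kernel E E) (ξ : E → EuclideanSpace ℝ (Fin d)) (j : ℕ)
    (O : Set (EuclideanSpace ℝ (Fin d))) (B B' : FunSpace E) : Prop :=
  ∃ U : EuclideanSpace ℝ (Fin d) → (B.V →L[ℂ] B'.V),
    (∀ t ∈ O, IsFourierOp Q ξ t B B' (U t)) ∧ ContDiffOn ℝ j U O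

/-- Condition (K1), strong ergodicity: `Q ∈ 𝓛(B)` and `‖Qⁿ - Π‖ → 0` in `𝓛(B)`, where
`Π f = π(f) 1`. -/
def StronglyErgodic (Q : Kernel E E) (π : Measure E) (B : FunSpace E) : Prop :=
  ∃ T P : B.V →L[ℂ] B.V,
    (∀ (f : B.V) (x : E), Integrable (B.toFun f) (Q x) ∧
      B.toFun (T f) x = ∫ y, B.toFun f y ∂(Q x)) ∧
    (∀ (f : B.V) (x : E), B.toFun (P f) x = ∫ y, B.toFun f y ∂π) ∧
    Tendsto (fun n : ℕ => ‖T ^ n - P‖) atTop (𝓝 0)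

/-- Condition (K) on `B`: strong ergodicity on `B` and, on a neighbourhood `O` of `0`,
boundedness of `Q(t)` on `B` and on `𝕃¹(π)`, continuity of `t ↦ Q(t)` in `𝓛(B, 𝕃¹(π))`, and
the Doeblin-Fortet inequalities with auxiliary norm that of `𝕃¹(π)`. Here `J` is the
map `f ↦ Cl(f)` from `B` to `𝕃¹(π)`, and `U t`, `R t` are `Q(t)` on `B` and on `𝕃¹(π)`. -/
def ConditionK (Q : Kernel E E) (ξ : E → EuclideanSpace ℝ (Fin d)) (π : Measure E)
    (B : FunSpace E) : Prop :=
  StronglyErgodic Q π B ∧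
  ∃ (O : Set (EuclideanSpace ℝ (Fin d)))
    (U : EuclideanSpace ℝ (Fin d) → (B.V →L[ℂ] B.V))
    (R : EuclideanSpace ℝ (Fin d) → (Lp ℂ 1 π →L[ℂ] Lp ℂ 1 π))
    (J : B.V →L[ℂ] Lp ℂ 1 π),
    IsOpen O ∧ 0 ∈ O ∧
    (∀ t ∈ O, IsFourierOp Q ξ t B B (U t)) ∧
    (∀ t ∈ O, IsFourierOpL1 Q ξ π t (R t)) ∧
    (∀ f : B.V, J f =ᵐ[π] B.toFun f) ∧
    (∀ t ∈ O, Tendsto (fun h => ‖(R (t + h)).comp J - (R t).comp J‖) (𝓝 0) (𝓝 0)) ∧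
    ∃ κ c : ℝ, 0 ≤ κ ∧ κ < 1 ∧ 0 < c ∧
      ∀ n : ℕ, 1 ≤ n → ∀ f : B.V, ∀ t ∈ O,
        ‖(U t ^ n) f‖ ≤ c * κ ^ n * ‖f‖ + c * ∫ x, ‖B.toFun f x‖ ∂π

/-- Hypothesis `𝒞(m)` for the pair `(B, B')`.

The maps `T₀, T₁ : I → ℝ` are taken as total maps `ℝ → ℝ`. This changes nothing: if `I ≠ ℝ`, the
maps on `I` can be extended by a constant value `∉ I`, so that an orbit which leaves `I` never
returns to `I`, and `θ_j ∈ I` then says that `θ_j` is defined and lies in `I`. -/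
def HypothesisC (m : ℕ) (Q : Kernel E E) (ξ : E → EuclideanSpace ℝ (Fin d)) (π : Measure E)
    (B B' : FunSpace E) : Prop :=
  ∃ (I : Set ℝ) (fam : ℝ → FunSpace E) (T₀ T₁ : ℝ → ℝ),
    (∀ θ ∈ I, (fam θ).IsAdmissible π) ∧
    (∀ θ ∈ I, (fam θ).Embeds B') ∧
    (∀ θ ∈ I,
      (T₀ θ ∈ I → (fam θ).Embeds (fam (T₀ θ))) ∧
      (T₁ θ ∈ I → (fam θ).Embeds (fam (T₁ θ))) ∧
      (∃ O : Set (EuclideanSpace ℝ (Fin d)), IsOpen O ∧ 0 ∈ O ∧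
        (T₀ θ ∈ I → FourierContDiff Q ξ 0 O (fam θ) (fam (T₀ θ))) ∧
        (∀ j : ℕ, 1 ≤ j → j ≤ m → T₁ ((T₀ ∘ T₁)^[j - 1] θ) ∈ I →
          FourierContDiff Q ξ j O (fam θ) (fam (T₁ ((T₀ ∘ T₁)^[j - 1] θ))))) ∧
      ConditionK Q ξ π (fam θ)) ∧
    ∃ a : ℝ,
      (∀ k : ℕ, k ≤ m → (T₀ ∘ T₁)^[k] (T₀ a) ∈ I ∧ (T₁ ∘ T₀)^[k] a ∈ I) ∧
      fam a = B ∧ fam ((T₀ ∘ T₁)^[m] (T₀ a)) = B'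

end Operators

/-! ### The weighted Hölder spaces `𝓑_{α,β,γ}` -/

section Holder

variable {E : Type u} [MetricSpace E]

/-- `p(x) = 1 + d(x, x₀)`. -/
def weight (x₀ x : E) : ℝ := 1 + dist x x₀

/-- `Δ_{α,β,γ}(x,y) = p(x)^{αγ} p(y)^{αβ} + p(x)^{αβ} p(y)^{αγ}`. -/
def weightΔ (x₀ : E) (α β γ : ℝ) (x y : E) : ℝ :=
  weight x₀ x ^ (α * γ) * weight x₀ y ^ (α * β) + weight x₀ x ^ (α * β) * weight x₀ y ^ (α * γ)

/-- The quotients `|f(x) - f(y)| / (d(x,y)^α Δ_{α,β,γ}(x,y))`, `x ≠ y`. -/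
def holderQuot (x₀ : E) (α β γ : ℝ) (f : E → ℂ) (z : {z : E × E // z.1 ≠ z.2}) : ℝ :=
  ‖f z.1.1 - f z.1.2‖ / (dist z.1.1 z.1.2 ^ α * weightΔ x₀ α β γ z.1.1 z.1.2)

/-- The quotients `|f(x)| / p(x)^{α(γ+1)}`. -/
def weightQuot (x₀ : E) (α γ : ℝ) (f : E → ℂ) (x : E) : ℝ :=
  ‖f x‖ / weight x₀ x ^ (α * (γ + 1))

/-- `m_{α,β,γ}(f)`. -/
def holderSeminorm (x₀ : E) (α β γ : ℝ) (f : E → ℂ) : ℝ := ⨆ z, holderQuot x₀ α β γ f z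

/-- `|f|_{α,γ}`. -/
def weightNorm (x₀ : E) (α γ : ℝ) (f : E → ℂ) : ℝ := ⨆ x, weightQuot x₀ α γ f x

lemma one_le_weight (x₀ x : E) : 1 ≤ weight x₀ x := by
  unfold weight; linarith [dist_nonneg (x := x) (y := x₀)]

lemma weight_pos (x₀ x : E) : 0 < weight x₀ x := lt_of_lt_of_le one_pos (one_le_weight x₀ x)

lemma weightΔ_pos (x₀ : E) (α β γ : ℝ) (x y : E) : 0 < weightΔ x₀ α β γ x y := by
  have h1 := weight_pos x₀ x
  have h2 := weight_pos x₀ y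
  unfold weightΔ; positivity

lemma holderQuot_nonneg (x₀ : E) (α β γ : ℝ) (f : E → ℂ) (z) : 0 ≤ holderQuot x₀ α β γ f z := by
  have := weightΔ_pos x₀ α β γ z.1.1 z.1.2
  unfold holderQuot; positivity

lemma weightQuot_nonneg (x₀ : E) (α γ : ℝ) (f : E → ℂ) (x : E) : 0 ≤ weightQuot x₀ α γ f x := by
  have := weight_pos x₀ x
  unfold weightQuot; positivity

lemma holderQuot_add (x₀ : E) (α β γ : ℝ) (f g : E → ℂ) (z) :
    holderQuot x₀ α β γ (f + g) z ≤ holderQuot x₀ α β γ f z + holderQuot x₀ α β γ g z := by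
  have := weightΔ_pos x₀ α β γ z.1.1 z.1.2
  unfold holderQuot
  rw [← add_div]
  gcongr
  simp only [Pi.add_apply]
  rw [add_sub_add_comm]
  exact norm_add_le _ _

lemma weightQuot_add (x₀ : E) (α γ : ℝ) (f g : E → ℂ) (x : E) :
    weightQuot x₀ α γ (f + g) x ≤ weightQuot x₀ α γ f x + weightQuot x₀ α γ g x := by
  have := weight_pos x₀ x
  unfold weightQuot
  rw [← add_div]
  gcongr
  exact norm_add_le _ _

lemma holderQuot_smul (x₀ : E) (α β γ : ℝ) (c : ℂ) (f : E → ℂ) (z) :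
    holderQuot x₀ α β γ (c • f) z = ‖c‖ * holderQuot x₀ α β γ f z := by
  simp only [holderQuot, Pi.smul_apply, ← smul_sub, norm_smul, mul_div_assoc]

lemma weightQuot_smul (x₀ : E) (α γ : ℝ) (c : ℂ) (f : E → ℂ) (x : E) :
    weightQuot x₀ α γ (c • f) x = ‖c‖ * weightQuot x₀ α γ f x := by
  simp only [weightQuot, Pi.smul_apply, norm_smul, mul_div_assoc]

/-- The functions `f : E → ℂ` with `m_{α,β,γ}(f) < ∞` and `|f|_{α,γ} < ∞`. For `0 < α` and
`0 ≤ β ≤ γ` the second condition follows from the first, see `mem_holderSubmodule_iff`. -/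
def holderSubmodule (x₀ : E) (α β γ : ℝ) : Submodule ℂ (E → ℂ) where
  carrier := {f | BddAbove (Set.range (holderQuot x₀ α β γ f)) ∧
    BddAbove (Set.range (weightQuot x₀ α γ f))}
  zero_mem' := by
    constructor
    · exact ⟨0, by rintro _ ⟨z, rfl⟩; simp [holderQuot]⟩
    · exact ⟨0, by rintro _ ⟨z, rfl⟩; simp [weightQuot]⟩
  add_mem' := by
    rintro f g ⟨⟨a, ha⟩, ⟨b, hb⟩⟩ ⟨⟨a', ha'⟩, ⟨b', hb'⟩⟩
    refine ⟨⟨a + a', ?_⟩, ⟨b + b', ?_⟩⟩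
    · rintro _ ⟨z, rfl⟩
      exact (holderQuot_add x₀ α β γ f g z).trans (add_le_add (ha ⟨z, rfl⟩) (ha' ⟨z, rfl⟩))
    · rintro _ ⟨z, rfl⟩
      exact (weightQuot_add x₀ α γ f g z).trans (add_le_add (hb ⟨z, rfl⟩) (hb' ⟨z, rfl⟩))
  smul_mem' := by
    rintro c f ⟨⟨a, ha⟩, ⟨b, hb⟩⟩
    refine ⟨⟨‖c‖ * a, ?_⟩, ⟨‖c‖ * b, ?_⟩⟩
    · rintro _ ⟨z, rfl⟩
      rw [holderQuot_smul]
      exact mul_le_mul_of_nonneg_left (ha ⟨z, rfl⟩) (norm_nonneg c)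
    · rintro _ ⟨z, rfl⟩
      rw [weightQuot_smul]
      exact mul_le_mul_of_nonneg_left (hb ⟨z, rfl⟩) (norm_nonneg c)

/-- In the relevant range of parameters, `𝓑_{α,β,γ}` is the space of all `f` such that
`m_{α,β,γ}(f) < ∞`. -/
lemma mem_holderSubmodule_iff (x₀ : E) {α β γ : ℝ} (hα : 0 < α) (hβ : 0 ≤ β) (hβγ : β ≤ γ)
    (f : E → ℂ) :
    f ∈ holderSubmodule x₀ α β γ ↔ BddAbove (Set.range (holderQuot x₀ α β γ f)) := by
  refine ⟨fun h => h.1, fun h => ⟨h, ?_⟩⟩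
  obtain ⟨A, hA⟩ := h
  have hA0 : 0 ≤ max A 0 := le_max_right _ _
  refine ⟨‖f x₀‖ + 2 * max A 0, ?_⟩
  rintro _ ⟨x, rfl⟩
  have hp := weight_pos x₀ x
  have hp1 := one_le_weight x₀ x
  have hE : 1 ≤ weight x₀ x ^ (α * (γ + 1)) := Real.one_le_rpow hp1 (by nlinarith)
  unfold weightQuot
  rw [div_le_iff₀ (by positivity)]
  by_cases hx : x = x₀
  · subst hx
    nlinarith [norm_nonneg (f x), mul_nonneg (norm_nonneg (f x)) (sub_nonneg.2 hE)]
  · have hd : 0 < dist x x₀ := dist_pos.2 hx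
    have hq : holderQuot x₀ α β γ f ⟨(x, x₀), hx⟩ ≤ max A 0 :=
      (hA ⟨⟨(x, x₀), hx⟩, rfl⟩).trans (le_max_left _ _)
    have hΔ := weightΔ_pos x₀ α β γ x x₀
    unfold holderQuot at hq
    simp only at hq
    rw [div_le_iff₀ (by positivity)] at hq
    have hw : weight x₀ x₀ = 1 := by simp [weight]
    have hΔle : weightΔ x₀ α β γ x x₀ ≤ 2 * weight x₀ x ^ (α * γ) := by
      unfold weightΔ
      rw [hw, Real.one_rpow, Real.one_rpow, mul_one, mul_one, two_mul]
      gcongr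
    have hdle : dist x x₀ ^ α ≤ weight x₀ x ^ α :=
      Real.rpow_le_rpow hd.le (by unfold weight; linarith) hα.le
    have hmul : weight x₀ x ^ α * weight x₀ x ^ (α * γ) = weight x₀ x ^ (α * (γ + 1)) := by
      rw [← Real.rpow_add hp]; ring_nf
    have h1 : dist x x₀ ^ α * weightΔ x₀ α β γ x x₀ ≤ 2 * weight x₀ x ^ (α * (γ + 1)) := by
      calc dist x x₀ ^ α * weightΔ x₀ α β γ x x₀
          ≤ weight x₀ x ^ α * (2 * weight x₀ x ^ (α * γ)) :=
            mul_le_mul hdle hΔle hΔ.le (by positivity)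
        _ = 2 * weight x₀ x ^ (α * (γ + 1)) := by rw [← hmul]; ring
    have h2 : ‖f x‖ ≤ ‖f x₀‖ + ‖f x - f x₀‖ := by
      have := norm_add_le (f x₀) (f x - f x₀)
      simpa using this
    have h3 := mul_le_mul_of_nonneg_left h1 hA0
    have h4 := mul_le_mul_of_nonneg_left hE (norm_nonneg (f x₀))
    linarith

/-- The space `𝓑_{α,β,γ}`, as a type of its own (to carry its norm, and not the topology of
pointwise convergence). -/
def WHolder (x₀ : E) (α β γ : ℝ) : Type u := ↥(holderSubmodule x₀ α β γ)

variable (x₀ : E) (α β γ : ℝ)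

instance : AddCommGroup (WHolder x₀ α β γ) :=
  inferInstanceAs (AddCommGroup ↥(holderSubmodule x₀ α β γ))

instance : Module ℂ (WHolder x₀ α β γ) :=
  inferInstanceAs (Module ℂ ↥(holderSubmodule x₀ α β γ))

/-- The function underlying an element of `𝓑_{α,β,γ}`. -/
def WHolder.toFunL : WHolder x₀ α β γ →ₗ[ℂ] (E → ℂ) := (holderSubmodule x₀ α β γ).subtype

/-- `‖f‖_{α,β,γ} = m_{α,β,γ}(f) + |f|_{α,γ}`. -/
instance : Norm (WHolder x₀ α β γ) :=
  ⟨fun f => holderSeminorm x₀ α β γ (WHolder.toFunL x₀ α β γ f) +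
    weightNorm x₀ α γ (WHolder.toFunL x₀ α β γ f)⟩

lemma WHolder.norm_def (f : WHolder x₀ α β γ) :
    ‖f‖ = holderSeminorm x₀ α β γ (WHolder.toFunL x₀ α β γ f) +
      weightNorm x₀ α γ (WHolder.toFunL x₀ α β γ f) := rfl

lemma WHolder.normCore : NormedSpace.Core ℂ (WHolder x₀ α β γ) where
  norm_nonneg f := by
    rw [WHolder.norm_def]
    exact add_nonneg (Real.iSup_nonneg fun z => holderQuot_nonneg _ _ _ _ _ z)
      (Real.iSup_nonneg fun x => weightQuot_nonneg _ _ _ _ x)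
  norm_smul c f := by
    simp only [WHolder.norm_def, map_smul, holderSeminorm, weightNorm, holderQuot_smul,
      weightQuot_smul]
    rw [← Real.mul_iSup_of_nonneg (norm_nonneg c), ← Real.mul_iSup_of_nonneg (norm_nonneg c),
      mul_add]
  norm_triangle f g := by
    simp only [WHolder.norm_def, map_add]
    have hf : WHolder.toFunL x₀ α β γ f ∈ holderSubmodule x₀ α β γ := Subtype.property f
    have hg : WHolder.toFunL x₀ α β γ g ∈ holderSubmodule x₀ α β γ := Subtype.property g
    have h1 : holderSeminorm x₀ α β γ
        (WHolder.toFunL x₀ α β γ f + WHolder.toFunL x₀ α β γ g) ≤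
        holderSeminorm x₀ α β γ (WHolder.toFunL x₀ α β γ f) +
        holderSeminorm x₀ α β γ (WHolder.toFunL x₀ α β γ g) :=
      Real.iSup_le (fun z => (holderQuot_add _ _ _ _ _ _ z).trans
        (add_le_add (le_ciSup hf.1 z) (le_ciSup hg.1 z)))
        (add_nonneg (Real.iSup_nonneg fun z => holderQuot_nonneg _ _ _ _ _ z)
          (Real.iSup_nonneg fun z => holderQuot_nonneg _ _ _ _ _ z))
    have h2 : weightNorm x₀ α γ
        (WHolder.toFunL x₀ α β γ f + WHolder.toFunL x₀ α β γ g) ≤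
        weightNorm x₀ α γ (WHolder.toFunL x₀ α β γ f) +
        weightNorm x₀ α γ (WHolder.toFunL x₀ α β γ g) :=
      Real.iSup_le (fun z => (weightQuot_add _ _ _ _ _ z).trans
        (add_le_add (le_ciSup hf.2 z) (le_ciSup hg.2 z)))
        (add_nonneg (Real.iSup_nonneg fun z => weightQuot_nonneg _ _ _ _ z)
          (Real.iSup_nonneg fun z => weightQuot_nonneg _ _ _ _ z))
    linarith
  norm_eq_zero_iff f := by
    constructor
    · intro h
      rw [WHolder.norm_def] at h
      have hf : WHolder.toFunL x₀ α β γ f ∈ holderSubmodule x₀ α β γ := Subtype.property f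
      have h1 : 0 ≤ holderSeminorm x₀ α β γ (WHolder.toFunL x₀ α β γ f) :=
        Real.iSup_nonneg fun z => holderQuot_nonneg _ _ _ _ _ z
      have h2 : weightNorm x₀ α γ (WHolder.toFunL x₀ α β γ f) ≤ 0 := by linarith
      apply Subtype.ext
      funext x
      have h3 : weightQuot x₀ α γ (WHolder.toFunL x₀ α β γ f) x ≤ 0 :=
        (le_ciSup hf.2 x).trans h2
      have hp : 0 < weight x₀ x ^ (α * (γ + 1)) := Real.rpow_pos_of_pos (weight_pos x₀ x) _
      unfold weightQuot at h3
      rw [div_le_iff₀ hp, zero_mul] at h3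
      exact norm_le_zero_iff.1 h3
    · rintro rfl
      simp [WHolder.norm_def, holderSeminorm, weightNorm, holderQuot, weightQuot]

instance : NormedAddCommGroup (WHolder x₀ α β γ) :=
  NormedAddCommGroup.ofCore (WHolder.normCore x₀ α β γ)

instance : NormedSpace ℂ (WHolder x₀ α β γ) :=
  NormedSpace.ofCore (WHolder.normCore x₀ α β γ)

/-- `𝓑_{α,β,γ}` with the norm `‖·‖_{α,β,γ}`. -/
def holderSpace : FunSpace E where
  V := WHolder x₀ α β γ
  toFun := WHolder.toFunL x₀ α β γ
  injective_toFun := Subtype.val_injective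

end Holder

/-! ### Iterative Lipschitz models -/

/-- The data of an iterative Lipschitz model `X_n = F(X_{n-1}, ϑ_n)`: a measurable map
`F : E × G → E` such that every `F(·, g)` is Lipschitz continuous, and the common law of the
i.i.d. `G`-valued random variables `ϑ_n`. -/
structure LipschitzModel (E : Type u) [MetricSpace E] [MeasurableSpace E]
    (G : Type v) [MeasurableSpace G] where
  F : E → G → E
  measurable_F : Measurable (Function.uncurry F)
  lipschitz_F : ∀ g, ∃ K, LipschitzWith K (fun x => F x g)
  law : Measure G
  [isProbabilityMeasure_law : IsProbabilityMeasure law]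

attribute [instance] LipschitzModel.isProbabilityMeasure_law

namespace LipschitzModel

variable {E : Type u} [MetricSpace E] [MeasurableSpace E] {G : Type v} [MeasurableSpace G]

/-- The transition kernel: `Q(x, ·)` is the law of `F(x, ϑ₁)`. -/
def kernel (𝓜 : LipschitzModel E G) : Kernel E E where
  toFun x := 𝓜.law.map (𝓜.F x)
  measurable' := by
    refine Measure.measurable_of_measurable_coe _ fun s hs => ?_
    have hF : ∀ x, Measurable (𝓜.F x) := fun x => 𝓜.measurable_F.comp measurable_prodMk_left
    simp_rw [fun x => Measure.map_apply (μ := 𝓜.law) (hF x) hs]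
    exact measurable_measure_prodMk_left (𝓜.measurable_F hs)

/-- `𝒞 = sup_{x ≠ y} d(F(x, ϑ₁), F(y, ϑ₁)) / d(x, y)`, as a function of the value `g` of `ϑ₁`. -/
def lipC (𝓜 : LipschitzModel E G) (g : G) : ℝ :=
  ⨆ z : {z : E × E // z.1 ≠ z.2}, dist (𝓜.F z.1.1 g) (𝓜.F z.1.2 g) / dist z.1.1 z.1.2

/-- `ℳ = 1 + 𝒞 + d(F(x₀, ϑ₁), x₀)`, as a function of the value `g` of `ϑ₁`. -/
def bigM (𝓜 : LipschitzModel E G) (x₀ : E) (g : G) : ℝ :=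
  1 + 𝓜.lipC g + dist (𝓜.F x₀ g) x₀

end LipschitzModel

/-- Condition `(L)_s` with constant `S`. -/
def ConditionL {E : Type u} [MetricSpace E] {d : ℕ} (x₀ : E)
    (ξ : E → EuclideanSpace ℝ (Fin d)) (S s : ℝ) : Prop :=
  ∀ x y : E, ‖ξ x - ξ y‖ ≤ S * dist x y * (1 + dist x x₀ + dist y x₀) ^ s

end SpectralMarkov

end

open SpectralMarkov

noncomputable section

namespace SpectralMarkov

universe u v

/-! ### Weights -/

/-! The operator `Q(t)` is multiplication by `e^{i⟨t,ξ⟩}` followed by `Q`. All dependence on `t`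
sits in the multiplier, and the proof separates a contraction property of `Q` from a calculus of
multipliers.

Contraction. Replace `p` by the equivalent weight `p_l = 1 + l d(·,x₀)`. One step of the model
multiplies `p_l` by at most `max{𝒞,1} + l d(F(x₀,ϑ₁),x₀)`, so `Q` multiplies the Hölder seminorm
built on `p_l` by at most the mean of `𝒞^α (max{𝒞,1} + l d(F(x₀,ϑ₁),x₀))^{α(γ'+β)}`. As `l → 0` this
tends, by domination, to the quantity assumed `< 1`; hence a factor `κ < 1`, the same for all
exponents up to `γ'` (`exists_contracts`, `norm_integral_kernel_sub_le`). The same hypothesis yields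
a drift condition, so `π` integrates `p^{α(γ'+1)}` (`integrable_weight`). Then `f - π(f)` is
controlled by the seminorm of `f` alone, and its geometric decay is strong ergodicity. For small `t`
the multiplier only adds `O(|t|^α)` times the seminorm plus `π(|f|)`, which gives the Doeblin-Fortet
inequalities (`doeblinFortet`).

Multipliers. An element of `𝓑_{α,β,γ}` grows like `p^{α(γ+1)}`, and the `α`-Hölder differences of
`e^{i⟨t,ξ⟩}` grow like `|t|^α p^{αs}`. Since `β ≥ s+1`, their product still fits into `Δ_{α,β,γ}`: a
unimodular multiplier costs nothing, and a factor growing like `p^r` costs `r/α` in `γ`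
(`IsSymbol.exists_mulOp`). From `|e^{iu}-1| ≤ 2|u|^η` and `|e^{iu}-1-iu| ≤ 2|u|^{1+η}` with small `η
> 0`, continuity in `t` costs an arbitrarily small increase of `γ`, and each derivative costs
`(s+1)/α` more; induction gives class `𝒞^n` (`PhaseBound.contDiff_mulOp`).

The scale is `𝓑_{α,β,θ}`, `θ ∈ [γ,γ']`, where `T₀` and `T₁` are translations by `ε` and `(s+1)/α +
ε`. The gap between `γ'` and `γ + m(s+1)/α` is shared equally among the `2m+1` translations. -/

lemma rpow_mul_rpow_le_rpow_mul_rpow {p q a b a' b' : ℝ} (hp : 1 ≤ p) (hpq : p ≤ q)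
    (ha : a' ≤ a) (hab : a + b ≤ a' + b') : p ^ a * q ^ b ≤ p ^ a' * q ^ b' := by
  have hp0 : 0 < p := by linarith
  have hq0 : 0 < q := by linarith
  -- Only the excess exponent `a - a'` is moved from the smaller base to the larger one.
  have h1 : p ^ a = p ^ a' * p ^ (a - a') := by rw [← Real.rpow_add hp0]; ring_nf
  rw [h1, mul_assoc]
  refine mul_le_mul_of_nonneg_left ?_ (by positivity)
  calc p ^ (a - a') * q ^ b ≤ q ^ (a - a') * q ^ b :=
        mul_le_mul_of_nonneg_right (Real.rpow_le_rpow hp0.le hpq (by linarith)) (by positivity)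
    _ = q ^ (a - a' + b) := (Real.rpow_add hq0 _ _).symm
    _ ≤ q ^ b' := Real.rpow_le_rpow_of_exponent_le (hp.trans hpq) (by linarith)

section Weights

variable {E : Type u} [MetricSpace E] (x₀ : E)

/-- `p_l(x) = 1 + l d(x, x₀)`. -/
def scaledWeight (l : ℝ) (x : E) : ℝ := 1 + l * dist x x₀

/-- The analogue of `Δ` for the weight `p_l`, with exponents `a` and `b`. -/
def scaledΔ (l a b : ℝ) (x y : E) : ℝ :=
  scaledWeight x₀ l x ^ a * scaledWeight x₀ l y ^ b +
    scaledWeight x₀ l x ^ b * scaledWeight x₀ l y ^ a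

lemma one_le_scaledWeight {l : ℝ} (hl : 0 ≤ l) (x : E) : 1 ≤ scaledWeight x₀ l x := by
  unfold scaledWeight
  have := mul_nonneg hl (dist_nonneg (x := x) (y := x₀))
  linarith

lemma scaledWeight_pos {l : ℝ} (hl : 0 ≤ l) (x : E) : 0 < scaledWeight x₀ l x :=
  one_pos.trans_le (one_le_scaledWeight x₀ hl x)

lemma scaledWeight_le_weight {l : ℝ} (hl1 : l ≤ 1) (x : E) :
    scaledWeight x₀ l x ≤ weight x₀ x := by
  unfold scaledWeight weight
  nlinarith [dist_nonneg (x := x) (y := x₀)]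

lemma mul_weight_le_scaledWeight {l : ℝ} (hl1 : l ≤ 1) (x : E) :
    l * weight x₀ x ≤ scaledWeight x₀ l x := by
  unfold scaledWeight weight
  nlinarith [dist_nonneg (x := x) (y := x₀)]

lemma scaledΔ_nonneg {l : ℝ} (hl : 0 ≤ l) (a b : ℝ) (x y : E) : 0 ≤ scaledΔ x₀ l a b x y := by
  have h1 := scaledWeight_pos x₀ hl x
  have h2 := scaledWeight_pos x₀ hl y
  unfold scaledΔ; positivity

lemma weightΔ_comm (α β γ : ℝ) (x y : E) : weightΔ x₀ α β γ x y = weightΔ x₀ α β γ y x := by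
  unfold weightΔ; ring

lemma scaledΔ_le_weightΔ {l α β γ : ℝ} (hl : 0 ≤ l) (hl1 : l ≤ 1) (ha : 0 ≤ α * γ)
    (hb : 0 ≤ α * β) (x y : E) : scaledΔ x₀ l (α * γ) (α * β) x y ≤ weightΔ x₀ α β γ x y := by
  have h1 := scaledWeight_pos x₀ hl x
  have h2 := scaledWeight_pos x₀ hl y
  have h3 := weight_pos x₀ x
  have h4 := weight_pos x₀ y
  unfold scaledΔ weightΔ
  gcongr <;> exact scaledWeight_le_weight x₀ hl1 _

/-- For `l ≤ 1` one has `l p ≤ p_l ≤ p`. The seminorms built on `p` and `p_l` are therefore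
equivalent, so a contraction proved for `p_l` can be read off in the original norm. -/
lemma weightΔ_le_mul_scaledΔ {l α β γ : ℝ} (hl : 0 < l) (hl1 : l ≤ 1) (ha : 0 ≤ α * γ)
    (hb : 0 ≤ α * β) (x y : E) :
    weightΔ x₀ α β γ x y ≤ l ^ (-(α * γ + α * β)) * scaledΔ x₀ l (α * γ) (α * β) x y := by
  have h3 := weight_pos x₀ x
  have h4 := weight_pos x₀ y
  have key : l ^ (α * γ + α * β) * weightΔ x₀ α β γ x y ≤ scaledΔ x₀ l (α * γ) (α * β) x y := by
    have : l ^ (α * γ + α * β) * weightΔ x₀ α β γ x y =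
        (l * weight x₀ x) ^ (α * γ) * (l * weight x₀ y) ^ (α * β) +
        (l * weight x₀ x) ^ (α * β) * (l * weight x₀ y) ^ (α * γ) := by
      rw [Real.mul_rpow hl.le h3.le, Real.mul_rpow hl.le h3.le, Real.mul_rpow hl.le h4.le,
        Real.mul_rpow hl.le h4.le, Real.rpow_add hl]
      unfold weightΔ; ring
    rw [this]
    unfold scaledΔ
    have h1 := scaledWeight_pos x₀ hl.le x
    have h2 := scaledWeight_pos x₀ hl.le y
    gcongr <;> exact mul_weight_le_scaledWeight x₀ hl1 _
  rw [Real.rpow_neg hl.le, inv_mul_eq_div, le_div_iff₀ (by positivity)]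
  linarith

lemma dist_le_weight_mul_weight (x y : E) : dist x y ≤ weight x₀ x * weight x₀ y := by
  have h := dist_triangle_right x y x₀
  unfold weight
  nlinarith [dist_nonneg (x := x) (y := x₀), dist_nonneg (x := y) (y := x₀),
    mul_nonneg (dist_nonneg (x := x) (y := x₀)) (dist_nonneg (x := y) (y := x₀))]

/-- The right side is a product of a function of `x` and a function of `y`, so the Hölder bound can
be integrated in `y` against a measure with moments. -/
lemma dist_rpow_mul_weightΔ_le {α β γ : ℝ} (hα : 0 < α) (hβγ : β ≤ γ) (x y : E) :
    dist x y ^ α * weightΔ x₀ α β γ x y ≤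
      2 * (weight x₀ x ^ (α * (γ + 1)) * weight x₀ y ^ (α * (γ + 1))) := by
  have h3 := weight_pos x₀ x
  have h4 := weight_pos x₀ y
  have h3' := one_le_weight x₀ x
  have h4' := one_le_weight x₀ y
  have hab : α * β ≤ α * γ := by gcongr
  have e1 : ∀ z : E, weight x₀ z ^ (α * (γ + 1)) = weight x₀ z ^ α * weight x₀ z ^ (α * γ) :=
    fun z => by rw [← Real.rpow_add (weight_pos x₀ z)]; ring_nf
  have hd : dist x y ^ α ≤ weight x₀ x ^ α * weight x₀ y ^ α := by
    rw [← Real.mul_rpow h3.le h4.le]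
    exact Real.rpow_le_rpow dist_nonneg (dist_le_weight_mul_weight x₀ x y) hα.le
  have hΔ : weightΔ x₀ α β γ x y ≤ 2 * (weight x₀ x ^ (α * γ) * weight x₀ y ^ (α * γ)) := by
    unfold weightΔ
    rw [two_mul]
    gcongr
  calc _ ≤ (weight x₀ x ^ α * weight x₀ y ^ α) *
        (2 * (weight x₀ x ^ (α * γ) * weight x₀ y ^ (α * γ))) :=
        mul_le_mul hd hΔ (weightΔ_pos x₀ _ _ _ _ _).le (by positivity)
    _ = _ := by rw [e1, e1]; ring

lemma continuous_weight : Continuous (weight x₀) := by unfold weight; fun_prop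

lemma continuous_weight_rpow (a : ℝ) : Continuous fun x => weight x₀ x ^ a :=
  (continuous_weight x₀).rpow_const fun x => Or.inl (weight_pos x₀ x).ne'

lemma continuous_of_holder_bound {α β γ A : ℝ} (hα : 0 < α) {f : E → ℂ}
    (hf : ∀ x y, ‖f x - f y‖ ≤ A * (dist x y ^ α * weightΔ x₀ α β γ x y)) : Continuous f := by
  rw [continuous_iff_continuousAt]
  intro y
  rw [ContinuousAt, tendsto_iff_norm_sub_tendsto_zero]
  have hc : Continuous fun x => A * (dist x y ^ α * weightΔ x₀ α β γ x y) := by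
    unfold weightΔ
    have h1 := continuous_weight_rpow x₀ (α * γ)
    have h2 := continuous_weight_rpow x₀ (α * β)
    have h3 : Continuous fun x => dist x y ^ α :=
      (continuous_id.dist continuous_const).rpow_const fun x => Or.inr hα.le
    fun_prop
  have ht := hc.tendsto y
  simp only [dist_self, Real.zero_rpow hα.ne', zero_mul, mul_zero] at ht
  exact squeeze_zero (fun x => norm_nonneg _) (fun x => hf x y) ht

end Weights

/-! ### The spaces `𝓑_{α,β,γ}` -/

namespace WHolder

variable {E : Type u} [MetricSpace E] {x₀ : E} {α β γ : ℝ}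

/-- The value of an element of `𝓑_{α,β,γ}` at a point. -/
instance : CoeFun (WHolder x₀ α β γ) fun _ => E → ℂ := ⟨fun f => toFunL x₀ α β γ f⟩

lemma ext_fun {f g : WHolder x₀ α β γ} (h : ∀ x, f x = g x) : f = g :=
  Subtype.ext (funext h)

@[simp] lemma add_apply (f g : WHolder x₀ α β γ) (x : E) : (f + g) x = f x + g x := by
  simp only [map_add, Pi.add_apply]

@[simp] lemma sub_apply (f g : WHolder x₀ α β γ) (x : E) : (f - g) x = f x - g x := by
  simp only [map_sub, Pi.sub_apply]

@[simp] lemma smul_apply (c : ℂ) (f : WHolder x₀ α β γ) (x : E) : (c • f) x = c * f x := by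
  simp only [map_smul, Pi.smul_apply, smul_eq_mul]

lemma holderSeminorm_le_norm (f : WHolder x₀ α β γ) : holderSeminorm x₀ α β γ f ≤ ‖f‖ := by
  rw [norm_def]
  linarith [show 0 ≤ weightNorm x₀ α γ f from Real.iSup_nonneg fun x => weightQuot_nonneg _ _ _ _ x]

lemma weightNorm_le_norm (f : WHolder x₀ α β γ) : weightNorm x₀ α γ f ≤ ‖f‖ := by
  rw [norm_def]
  linarith [show 0 ≤ holderSeminorm x₀ α β γ f from
    Real.iSup_nonneg fun x => holderQuot_nonneg _ _ _ _ _ x]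

lemma norm_sub_le (f : WHolder x₀ α β γ) (x y : E) :
    ‖f x - f y‖ ≤ ‖f‖ * (dist x y ^ α * weightΔ x₀ α β γ x y) := by
  have hΔ := weightΔ_pos x₀ α β γ x y
  by_cases hxy : x = y
  · subst hxy
    simp only [sub_self, norm_zero]
    have := norm_nonneg f
    positivity
  · have hf : toFunL x₀ α β γ f ∈ holderSubmodule x₀ α β γ := Subtype.property f
    have h1 := (le_ciSup hf.1 ⟨(x, y), hxy⟩).trans (holderSeminorm_le_norm f)
    have hd : 0 < dist x y := dist_pos.2 hxy
    unfold holderQuot at h1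
    rwa [div_le_iff₀ (by positivity)] at h1

lemma norm_apply_le (f : WHolder x₀ α β γ) (x : E) :
    ‖f x‖ ≤ ‖f‖ * weight x₀ x ^ (α * (γ + 1)) := by
  have hf : toFunL x₀ α β γ f ∈ holderSubmodule x₀ α β γ := Subtype.property f
  have h1 := (le_ciSup hf.2 x).trans (weightNorm_le_norm f)
  have hp := weight_pos x₀ x
  unfold weightQuot at h1
  rwa [div_le_iff₀ (by positivity)] at h1

lemma continuous (hα : 0 < α) (f : WHolder x₀ α β γ) : Continuous (toFunL x₀ α β γ f) :=
  continuous_of_holder_bound x₀ hα (norm_sub_le f)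

lemma holderQuot_le {A : ℝ} {f : E → ℂ}
    (hf : ∀ x y, ‖f x - f y‖ ≤ A * (dist x y ^ α * weightΔ x₀ α β γ x y))
    (z : {z : E × E // z.1 ≠ z.2}) : holderQuot x₀ α β γ f z ≤ A := by
  have hΔ := weightΔ_pos x₀ α β γ z.1.1 z.1.2
  have hd : 0 < dist z.1.1 z.1.2 := dist_pos.2 z.2
  unfold holderQuot
  rw [div_le_iff₀ (by positivity)]
  exact hf _ _

lemma weightQuot_le {B : ℝ} {f : E → ℂ} (hf : ∀ x, ‖f x‖ ≤ B * weight x₀ x ^ (α * (γ + 1)))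
    (x : E) : weightQuot x₀ α γ f x ≤ B := by
  have hp := weight_pos x₀ x
  unfold weightQuot
  rw [div_le_iff₀ (by positivity)]
  exact hf _

/-- An element of `𝓑_{α,β,γ}` from a function with suitable bounds. -/
def mk {A B : ℝ} (f : E → ℂ)
    (hA : ∀ x y, ‖f x - f y‖ ≤ A * (dist x y ^ α * weightΔ x₀ α β γ x y))
    (hB : ∀ x, ‖f x‖ ≤ B * weight x₀ x ^ (α * (γ + 1))) : WHolder x₀ α β γ :=
  ⟨f, ⟨A, by rintro _ ⟨z, rfl⟩; exact holderQuot_le hA z⟩,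
    ⟨B, by rintro _ ⟨z, rfl⟩; exact weightQuot_le hB z⟩⟩

@[simp] lemma mk_apply {A B : ℝ} (f : E → ℂ)
    (hA : ∀ x y, ‖f x - f y‖ ≤ A * (dist x y ^ α * weightΔ x₀ α β γ x y))
    (hB : ∀ x, ‖f x‖ ≤ B * weight x₀ x ^ (α * (γ + 1))) (x : E) : mk f hA hB x = f x := rfl

lemma norm_le {A B : ℝ} (hA0 : 0 ≤ A) (hB0 : 0 ≤ B) (f : WHolder x₀ α β γ)
    (hA : ∀ x y, ‖f x - f y‖ ≤ A * (dist x y ^ α * weightΔ x₀ α β γ x y))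
    (hB : ∀ x, ‖f x‖ ≤ B * weight x₀ x ^ (α * (γ + 1))) : ‖f‖ ≤ A + B := by
  rw [norm_def]
  exact add_le_add (Real.iSup_le (holderQuot_le hA) hA0) (Real.iSup_le (weightQuot_le hB) hB0)

/-- A linear map into `𝓑_{α,β,γ'}` given by pointwise values, from pointwise bounds. -/
lemma exists_clm {V : Type*} [NormedAddCommGroup V] [NormedSpace ℂ V] {A B : ℝ}
    (hA0 : 0 ≤ A) (hB0 : 0 ≤ B) (L : V →ₗ[ℂ] (E → ℂ))
    (hA : ∀ v x y, ‖L v x - L v y‖ ≤ A * ‖v‖ * (dist x y ^ α * weightΔ x₀ α β γ x y))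
    (hB : ∀ v x, ‖L v x‖ ≤ B * ‖v‖ * weight x₀ x ^ (α * (γ + 1))) :
    ∃ T : V →L[ℂ] WHolder x₀ α β γ, (∀ v x, T v x = L v x) ∧ ‖T‖ ≤ A + B := by
  let T₀ : V →ₗ[ℂ] WHolder x₀ α β γ :=
    { toFun := fun v => mk (L v) (hA v) (hB v)
      map_add' := fun v w => ext_fun fun x => by simp
      map_smul' := fun c v => ext_fun fun x => by simp }
  refine ⟨T₀.mkContinuous (A + B) fun v => ?_, fun v x => rfl,
    LinearMap.mkContinuous_norm_le _ (by positivity) _⟩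
  rw [add_mul]
  exact norm_le (by positivity) (by positivity) _ (hA v) (hB v)

lemma completeSpace : CompleteSpace (WHolder x₀ α β γ) := by
  refine Metric.complete_of_cauchySeq_tendsto fun u hu => ?_
  have hpt : ∀ x, CauchySeq fun n => u n x := by
    intro x
    rw [Metric.cauchySeq_iff'] at hu ⊢
    intro ε hε
    have hp : 0 < weight x₀ x ^ (α * (γ + 1)) := Real.rpow_pos_of_pos (weight_pos x₀ x) _
    obtain ⟨N, hN⟩ := hu (ε / weight x₀ x ^ (α * (γ + 1))) (by positivity)
    refine ⟨N, fun n hn => ?_⟩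
    have h1 := hN n hn
    rw [dist_eq_norm, lt_div_iff₀ hp] at h1
    rw [dist_eq_norm, ← sub_apply]
    exact (norm_apply_le _ x).trans_lt h1
  choose f hf using fun x => cauchySeq_tendsto_of_complete (hpt x)
  obtain ⟨R, hR⟩ := hu.norm_bddAbove
  have hR' : ∀ n, ‖u n‖ ≤ R := fun n => hR ⟨n, rfl⟩
  have hA : ∀ x y, ‖f x - f y‖ ≤ R * (dist x y ^ α * weightΔ x₀ α β γ x y) := fun x y =>
    le_of_tendsto ((hf x).sub (hf y)).norm (Eventually.of_forall fun n =>
      (norm_sub_le (u n) x y).trans (mul_le_mul_of_nonneg_right (hR' n)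
        (by have := weightΔ_pos x₀ α β γ x y; positivity)))
  have hB : ∀ x, ‖f x‖ ≤ R * weight x₀ x ^ (α * (γ + 1)) := fun x =>
    le_of_tendsto (hf x).norm (Eventually.of_forall fun n =>
      (norm_apply_le (u n) x).trans (mul_le_mul_of_nonneg_right (hR' n)
        (by have := weight_pos x₀ x; positivity)))
  refine ⟨mk f hA hB, ?_⟩
  rw [Metric.tendsto_atTop]
  rw [Metric.cauchySeq_iff] at hu
  intro ε hε
  -- Each half of the norm receives `ε/4`, so that the sum is strictly below `ε`. The bounds on `u n
  -- - f` come from those on `u n - u k` by letting `k → ∞` pointwise.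
  obtain ⟨N, hN⟩ := hu (ε / 4) (by positivity)
  refine ⟨N, fun n hn => ?_⟩
  have hle : ∀ k, N ≤ k → ‖u n - u k‖ ≤ ε / 4 := fun k hk => by
    rw [← dist_eq_norm]; exact (hN n hn k hk).le
  rw [dist_eq_norm]
  refine lt_of_le_of_lt (norm_le (A := ε / 4) (B := ε / 4) (by positivity) (by positivity) _
    (fun x y => ?_) (fun x => ?_)) (by linarith)
  · refine le_of_tendsto (f := fun k => ‖(u n - u k) x - (u n - u k) y‖) (x := atTop) ?_ ?_
    · simp only [sub_apply, mk_apply]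
      exact ((tendsto_const_nhds.sub (hf x)).sub (tendsto_const_nhds.sub (hf y))).norm
    · filter_upwards [eventually_ge_atTop N] with k hk
      exact (norm_sub_le (u n - u k) x y).trans (mul_le_mul_of_nonneg_right (hle k hk)
        (by have := weightΔ_pos x₀ α β γ x y; positivity))
  · refine le_of_tendsto (f := fun k => ‖(u n - u k) x‖) (x := atTop) ?_ ?_
    · simp only [sub_apply, mk_apply]
      exact (tendsto_const_nhds.sub (hf x)).norm
    · filter_upwards [eventually_ge_atTop N] with k hk
      exact (norm_apply_le (u n - u k) x).trans (mul_le_mul_of_nonneg_right (hle k hk)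
        (by have := weight_pos x₀ x; positivity))

end WHolder

/-! ### Multipliers -/

section Symbols

variable {E : Type u} [MetricSpace E] {x₀ : E} {α β γ γ' s : ℝ}

/-- Multipliers of order `r`: functions with growth `p^r`, whose `α`-Hölder differences have
growth `p^{r + αs}`. -/
structure IsSymbol (x₀ : E) (α s r A : ℝ) (g : E → ℂ) : Prop where
  nonneg : 0 ≤ A
  norm_le : ∀ x, ‖g x‖ ≤ A * weight x₀ x ^ r
  norm_sub_le : ∀ x y, weight x₀ x ≤ weight x₀ y →
    ‖g x - g y‖ ≤ A * (dist x y ^ α * weight x₀ y ^ (r + α * s))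

/-- Orders add, while the loss `αs` is paid only once, because each term of the product rule has a
single differenced factor. -/
lemma IsSymbol.mul {r r' A A' : ℝ} {g g' : E → ℂ} (h : IsSymbol x₀ α s r A g)
    (h' : IsSymbol x₀ α s r' A' g') (hr : 0 ≤ r) :
    IsSymbol x₀ α s (r + r') (2 * (A * A')) (fun x => g x * g' x) where
  nonneg := by have := h.nonneg; have := h'.nonneg; positivity
  norm_le x := by
    have h0 := h.nonneg
    have h0' := h'.nonneg
    have hp := weight_pos x₀ x
    rw [norm_mul, Real.rpow_add hp]
    calc ‖g x‖ * ‖g' x‖ ≤ (A * weight x₀ x ^ r) * (A' * weight x₀ x ^ r') :=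
          mul_le_mul (h.norm_le x) (h'.norm_le x) (norm_nonneg _) (by positivity)
      _ ≤ 2 * ((A * weight x₀ x ^ r) * (A' * weight x₀ x ^ r')) := by
          have : 0 ≤ (A * weight x₀ x ^ r) * (A' * weight x₀ x ^ r') := by positivity
          linarith
      _ = _ := by ring
  norm_sub_le x y hxy := by
    have h0 := h.nonneg
    have h0' := h'.nonneg
    have hp := weight_pos x₀ x
    have hq := weight_pos x₀ y
    have e : g x * g' x - g y * g' y = g x * (g' x - g' y) + (g x - g y) * g' y := by ring
    have h1 : ‖g x * (g' x - g' y)‖ ≤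
        (A * weight x₀ y ^ r) * (A' * (dist x y ^ α * weight x₀ y ^ (r' + α * s))) := by
      rw [norm_mul]
      refine mul_le_mul ((h.norm_le x).trans ?_) (h'.norm_sub_le x y hxy) (norm_nonneg _)
        (by positivity)
      gcongr
    have h2 : ‖(g x - g y) * g' y‖ ≤
        (A * (dist x y ^ α * weight x₀ y ^ (r + α * s))) * (A' * weight x₀ y ^ r') := by
      rw [norm_mul]
      exact mul_le_mul (h.norm_sub_le x y hxy) (h'.norm_le y) (norm_nonneg _) (by positivity)
    rw [e]
    refine (norm_add_le _ _).trans ((add_le_add h1 h2).trans (le_of_eq ?_))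
    simp only [Real.rpow_add hq]
    ring

/-- The part of the Hölder estimate of a product in which the multiplier varies. -/
lemma norm_mul_norm_sub_le {r A B : ℝ} {f g : E → ℂ} (hA : 0 ≤ A) (hB : 0 ≤ B) (hα : 0 < α)
    (hβ : s + 1 ≤ β) (hβγ : β ≤ γ) (hr : α * γ + r ≤ α * γ')
    (hf : ∀ x, ‖f x‖ ≤ B * weight x₀ x ^ (α * (γ + 1)))
    (hg : ∀ x y, weight x₀ x ≤ weight x₀ y →
      ‖g x - g y‖ ≤ A * (dist x y ^ α * weight x₀ y ^ (r + α * s)))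
    (x y : E) (hxy : weight x₀ x ≤ weight x₀ y) :
    ‖f x‖ * ‖g x - g y‖ ≤ A * B * (dist x y ^ α * weightΔ x₀ α β γ' x y) := by
  have hp := weight_pos x₀ x
  have hq := weight_pos x₀ y
  -- This is where `s + 1 ≤ β` is spent: the total exponent `α(γ+1) + r + αs` must not exceed `αβ +
  -- αγ'`. The excess growth of `f` is moved to the point of larger weight.
  have key : weight x₀ x ^ (α * (γ + 1)) * weight x₀ y ^ (r + α * s) ≤
      weight x₀ x ^ (α * β) * weight x₀ y ^ (α * γ') :=
    rpow_mul_rpow_le_rpow_mul_rpow (one_le_weight x₀ x) hxy (by nlinarith) (by nlinarith)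
  have key' : weight x₀ x ^ (α * (γ + 1)) * weight x₀ y ^ (r + α * s) ≤
      weightΔ x₀ α β γ' x y := by
    unfold weightΔ
    have : 0 ≤ weight x₀ x ^ (α * γ') * weight x₀ y ^ (α * β) := by positivity
    linarith
  calc ‖f x‖ * ‖g x - g y‖
      ≤ (B * weight x₀ x ^ (α * (γ + 1))) * (A * (dist x y ^ α * weight x₀ y ^ (r + α * s))) :=
        mul_le_mul (hf x) (hg x y hxy) (norm_nonneg _) (by positivity)
    _ = A * B * (dist x y ^ α * (weight x₀ x ^ (α * (γ + 1)) * weight x₀ y ^ (r + α * s))) := by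
        ring
    _ ≤ _ := by gcongr

/-- A multiplier of order `r` maps `𝓑_{α,β,γ}` to `𝓑_{α,β,γ'}` when `αγ + r ≤ αγ'`. -/
lemma IsSymbol.exists_mulOp {r A : ℝ} {g : E → ℂ} (h : IsSymbol x₀ α s r A g) (hα : 0 < α)
    (hβ : s + 1 ≤ β) (hβγ : β ≤ γ) (hr : α * γ + r ≤ α * γ') :
    ∃ T : WHolder x₀ α β γ →L[ℂ] WHolder x₀ α β γ',
      (∀ f x, T f x = g x * f x) ∧ ‖T‖ ≤ 4 * A := by
  have hA := h.nonneg
  let L : WHolder x₀ α β γ →ₗ[ℂ] (E → ℂ) :=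
    { toFun := fun f x => g x * f x
      map_add' := fun f f' => by funext x; simp [mul_add]
      map_smul' := fun c f => by funext x; simp; ring }
  have main : ∀ (f : WHolder x₀ α β γ) (x y : E), weight x₀ x ≤ weight x₀ y →
      ‖g x * f x - g y * f y‖ ≤ 3 * A * ‖f‖ * (dist x y ^ α * weightΔ x₀ α β γ' x y) := by
    intro f x y hxy
    have hp := weight_pos x₀ x
    have hq := weight_pos x₀ y
    have hp1 := one_le_weight x₀ x
    have hfn := norm_nonneg f
    -- The undifferenced `f` is taken at the point of smaller weight and the undifferenced `g` at
    -- the point of larger weight, so that exponents only have to move from the smaller weight to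
    -- the larger.
    have e : g x * f x - g y * f y = f x * (g x - g y) + g y * (f x - f y) := by ring
    have h1 := norm_mul_norm_sub_le hA hfn hα hβ hβγ hr (WHolder.norm_apply_le f)
      h.norm_sub_le x y hxy
    have h2 : weightΔ x₀ α β γ x y * weight x₀ y ^ r ≤ 2 * weightΔ x₀ α β γ' x y := by
      have k1 : weight x₀ x ^ (α * γ) * weight x₀ y ^ (α * β + r) ≤
          weight x₀ x ^ (α * β) * weight x₀ y ^ (α * γ') :=
        rpow_mul_rpow_le_rpow_mul_rpow hp1 hxy (by nlinarith) (by nlinarith)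
      have k2 : weight x₀ x ^ (α * β) * weight x₀ y ^ (α * γ + r) ≤
          weight x₀ x ^ (α * β) * weight x₀ y ^ (α * γ') :=
        rpow_mul_rpow_le_rpow_mul_rpow hp1 hxy le_rfl (by nlinarith)
      have k3 : 0 ≤ weight x₀ x ^ (α * γ') * weight x₀ y ^ (α * β) := by positivity
      rw [Real.rpow_add hq] at k1 k2
      unfold weightΔ
      linarith
    have h3 : ‖g y * (f x - f y)‖ ≤ 2 * A * ‖f‖ * (dist x y ^ α * weightΔ x₀ α β γ' x y) := by
      rw [norm_mul]
      calc _ ≤ (A * weight x₀ y ^ r) * (‖f‖ * (dist x y ^ α * weightΔ x₀ α β γ x y)) :=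
            mul_le_mul (h.norm_le y) (WHolder.norm_sub_le f x y) (norm_nonneg _) (by positivity)
        _ = A * ‖f‖ * dist x y ^ α * (weightΔ x₀ α β γ x y * weight x₀ y ^ r) := by ring
        _ ≤ A * ‖f‖ * dist x y ^ α * (2 * weightΔ x₀ α β γ' x y) := by gcongr
        _ = _ := by ring
    rw [e]
    refine (norm_add_le _ _).trans ?_
    rw [norm_mul (f x)]
    linarith
  obtain ⟨T, hT, hTn⟩ := WHolder.exists_clm (x₀ := x₀) (α := α) (β := β) (γ := γ') (A := 3 * A)
    (B := A) (by positivity) hA L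
    (fun f x y => by
      rcases le_total (weight x₀ x) (weight x₀ y) with hxy | hxy
      · exact main f x y hxy
      · have := main f y x hxy
        rwa [norm_sub_rev, dist_comm, weightΔ_comm] at this)
    (fun f x => by
      have hp := weight_pos x₀ x
      have hp1 := one_le_weight x₀ x
      change ‖g x * f x‖ ≤ _
      rw [norm_mul]
      calc _ ≤ (A * weight x₀ x ^ r) * (‖f‖ * weight x₀ x ^ (α * (γ + 1))) :=
            mul_le_mul (h.norm_le x) (WHolder.norm_apply_le f x) (norm_nonneg _) (by positivity)
        _ = A * ‖f‖ * weight x₀ x ^ (r + α * (γ + 1)) := by rw [Real.rpow_add hp]; ring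
        _ ≤ _ := by
          have hfn := norm_nonneg f
          gcongr
          linarith)
  exact ⟨T, hT, hTn.trans (by linarith)⟩

lemma isSymbol_one (α s : ℝ) : IsSymbol x₀ α s 0 1 (fun _ => 1) where
  nonneg := zero_le_one
  norm_le x := by simp
  norm_sub_le x y _ := by
    have := weight_pos x₀ y
    simp only [sub_self, norm_zero]
    positivity

/-- An operator is determined by its pointwise values. The bound thus applies to operators obtained
otherwise, such as differences and Taylor remainders of `t ↦ Q(t)` multipliers. -/
lemma norm_le_of_mulOp {r A : ℝ} {g : E → ℂ} (h : IsSymbol x₀ α s r A g) (hα : 0 < α)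
    (hβ : s + 1 ≤ β) (hβγ : β ≤ γ) (hr : α * γ + r ≤ α * γ')
    (T : WHolder x₀ α β γ →L[ℂ] WHolder x₀ α β γ') (hT : ∀ f x, T f x = g x * f x) :
    ‖T‖ ≤ 4 * A := by
  obtain ⟨T', hT', hn⟩ := h.exists_mulOp hα hβ hβγ hr
  have : T = T' := by
    ext1 f
    exact WHolder.ext_fun fun x => by rw [hT, hT']
  rwa [this]

/-- The inclusion `𝓑_{α,β,γ} ↪ 𝓑_{α,β,γ'}` for `γ ≤ γ'`. -/
lemma holderSpace_embeds (hα : 0 < α) (hβ : s + 1 ≤ β) (hβγ : β ≤ γ) (h : γ ≤ γ') :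
    (holderSpace x₀ α β γ).Embeds (holderSpace x₀ α β γ') := by
  obtain ⟨T, hT, -⟩ := (isSymbol_one (x₀ := x₀) α s).exists_mulOp (γ' := γ') hα hβ hβγ
    (by nlinarith)
  exact ⟨T, fun f => funext fun x => (hT f x).trans (one_mul _)⟩

end Symbols

/-! ### Estimates for `e^{iu}` -/

section ExpEstimates

/-- Interpolation between the bounds `|u|` and `2`; the free exponent `η` balances smallness in `t`
against growth in `x`. -/
lemma norm_exp_mul_I_sub_one_le (u : ℝ) {η : ℝ} (hη0 : 0 ≤ η) (hη1 : η ≤ 1) :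
    ‖Complex.exp ((u : ℂ) * Complex.I) - 1‖ ≤ 2 * |u| ^ η := by
  rcases le_total |u| 1 with hu | hu
  · have h1 : ‖Complex.exp ((u : ℂ) * Complex.I) - 1‖ ≤ |u| := by
      rw [mul_comm]; exact Real.norm_exp_I_mul_ofReal_sub_one_le
    have h2 : |u| ≤ |u| ^ η := Real.self_le_rpow_of_le_one (abs_nonneg u) hu hη1
    linarith [abs_nonneg u]
  · have h1 : ‖Complex.exp ((u : ℂ) * Complex.I) - 1‖ ≤ 2 := by
      refine (norm_sub_le _ _).trans ?_
      rw [Complex.norm_exp_ofReal_mul_I, norm_one]; norm_num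
    have h2 : 1 ≤ |u| ^ η := Real.one_le_rpow hu hη0
    linarith

lemma exp_mul_I_sub_exp_mul_I (u v : ℝ) :
    Complex.exp ((u : ℂ) * Complex.I) - Complex.exp ((v : ℂ) * Complex.I) =
      Complex.exp ((v : ℂ) * Complex.I) *
        (Complex.exp (((u - v : ℝ) : ℂ) * Complex.I) - 1) := by
  rw [mul_sub, ← Complex.exp_add, mul_one]
  push_cast
  ring_nf

lemma norm_exp_mul_I_sub_exp_mul_I_le (u v : ℝ) {η : ℝ} (hη0 : 0 ≤ η) (hη1 : η ≤ 1) :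
    ‖Complex.exp ((u : ℂ) * Complex.I) - Complex.exp ((v : ℂ) * Complex.I)‖ ≤
      2 * |u - v| ^ η := by
  rw [exp_mul_I_sub_exp_mul_I, norm_mul, Complex.norm_exp_ofReal_mul_I, one_mul]
  exact norm_exp_mul_I_sub_one_le _ hη0 hη1

/-- The second order remainder `e^{iu} - 1 - iu`. -/
def expRem (u : ℝ) : ℂ := Complex.exp ((u : ℂ) * Complex.I) - 1 - (u : ℂ) * Complex.I

lemma norm_expRem_le (u : ℝ) {η : ℝ} (hη0 : 0 ≤ η) (hη1 : η ≤ 1) :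
    ‖expRem u‖ ≤ 2 * (|u| * |u| ^ η) := by
  have hn : ‖(u : ℂ) * Complex.I‖ = |u| := by simp
  have h0 := abs_nonneg u
  unfold expRem
  rcases le_total |u| 1 with hu | hu
  · have h1 := Complex.norm_exp_sub_one_sub_id_le (hn.le.trans hu)
    rw [hn] at h1
    have h2 : |u| ≤ |u| ^ η := Real.self_le_rpow_of_le_one h0 hu hη1
    nlinarith
  · have h1 : ‖Complex.exp ((u : ℂ) * Complex.I) - 1‖ ≤ |u| := by
      rw [mul_comm]; exact Real.norm_exp_I_mul_ofReal_sub_one_le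
    have h2 : 1 ≤ |u| ^ η := Real.one_le_rpow hu hη0
    refine (norm_sub_le _ _).trans ?_
    rw [hn]
    nlinarith

lemma norm_expRem_sub_le (u v : ℝ) {η : ℝ} (hη0 : 0 ≤ η) (hη1 : η ≤ 1) :
    ‖expRem u - expRem v‖ ≤ 2 * |u - v| * (|u - v| ^ η + |v| ^ η) := by
  -- Factoring out `e^{iv}` leaves a factor `|u - v|` in both terms, times a power `η` that still
  -- supplies smallness.
  have e : expRem u - expRem v = Complex.exp ((v : ℂ) * Complex.I) * expRem (u - v) +
      (((u - v : ℝ) : ℂ) * Complex.I) * (Complex.exp ((v : ℂ) * Complex.I) - 1) := by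
    have := exp_mul_I_sub_exp_mul_I u v
    unfold expRem
    rw [show Complex.exp ((u : ℂ) * Complex.I) = Complex.exp ((v : ℂ) * Complex.I) *
        (Complex.exp (((u - v : ℝ) : ℂ) * Complex.I) - 1) + Complex.exp ((v : ℂ) * Complex.I) by
      rw [← this]; ring]
    push_cast
    ring
  rw [e]
  refine (norm_add_le _ _).trans ?_
  rw [norm_mul, norm_mul, Complex.norm_exp_ofReal_mul_I, one_mul]
  have h1 := norm_expRem_le (u - v) hη0 hη1
  have h2 := norm_exp_mul_I_sub_one_le v hη0 hη1
  have h3 : ‖((u - v : ℝ) : ℂ) * Complex.I‖ = |u - v| := by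
    rw [norm_mul, Complex.norm_I, mul_one, Complex.norm_real, Real.norm_eq_abs]
  rw [h3]
  have h4 := mul_le_mul_of_nonneg_left h2 (abs_nonneg (u - v))
  linarith

end ExpEstimates

/-! ### The multipliers `e^{i⟨t, ξ⟩}` -/

section Phase

section Basic

variable {E : Type u} {d : ℕ} {ξ : E → EuclideanSpace ℝ (Fin d)}

/-- The function `e^{i⟨t, ξ(x)⟩}`. -/
def phase (ξ : E → EuclideanSpace ℝ (Fin d)) (t : EuclideanSpace ℝ (Fin d)) (x : E) : ℂ :=
  Complex.exp (((inner ℝ t (ξ x) : ℝ) : ℂ) * Complex.I)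

lemma norm_phase (t : EuclideanSpace ℝ (Fin d)) (x : E) : ‖phase ξ t x‖ = 1 :=
  Complex.norm_exp_ofReal_mul_I _

lemma phase_add (t h : EuclideanSpace ℝ (Fin d)) (x : E) :
    phase ξ (t + h) x = phase ξ t x * phase ξ h x := by
  unfold phase
  rw [← Complex.exp_add, inner_add_left]
  push_cast
  ring_nf

end Basic

variable {E : Type u} [MetricSpace E] {x₀ : E} {α β γ γ' s : ℝ} {d : ℕ}
  {ξ : E → EuclideanSpace ℝ (Fin d)}

/-- Growth and regularity of `ξ`, in the form used for multipliers. -/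
structure PhaseBound (x₀ : E) (α s K : ℝ) (ξ : E → EuclideanSpace ℝ (Fin d)) : Prop where
  one_le : 1 ≤ K
  norm_le : ∀ x, ‖ξ x‖ ≤ K * weight x₀ x ^ (s + 1)
  norm_sub_rpow_le : ∀ x y, weight x₀ x ≤ weight x₀ y →
    ‖ξ x - ξ y‖ ^ α ≤ K * (dist x y ^ α * weight x₀ y ^ (α * s))
  norm_sub_le : ∀ x y, weight x₀ x ≤ weight x₀ y →
    ‖ξ x - ξ y‖ ≤ K * (dist x y ^ α * weight x₀ y ^ (s + 1 + α * s))

/-- Condition `(L)_s` is a Lipschitz bound, whereas the spaces only see `d^α`. Raising it to the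
power `α` gives the bound used for `e^{i⟨t,ξ⟩}`; interpolating it with the growth of `ξ` gives the
one used for `ξ` itself. -/
lemma ConditionL.exists_phaseBound {S : ℝ} (hL : ConditionL x₀ ξ S s) (hS : 0 ≤ S) (hs : 0 ≤ s)
    (hα : 0 < α) (hα1 : α ≤ 1) : ∃ K, PhaseBound x₀ α s K ξ := by
  set K : ℝ := 1 + ‖ξ x₀‖ + S * 2 ^ s with hK
  have h2s : (1 : ℝ) ≤ 2 ^ s := Real.one_le_rpow one_le_two hs
  have hn0 := norm_nonneg (ξ x₀)
  have hSs : S ≤ S * 2 ^ s := by nlinarith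
  have hK1 : 1 ≤ K := by linarith
  have hd1 : ∀ x y, weight x₀ x ≤ weight x₀ y →
      ‖ξ x - ξ y‖ ≤ K * (dist x y * weight x₀ y ^ s) := by
    intro x y hxy
    have hq := weight_pos x₀ y
    have h1 : (1 + dist x x₀ + dist y x₀) ^ s ≤ 2 ^ s * weight x₀ y ^ s := by
      rw [← Real.mul_rpow zero_le_two hq.le]
      refine Real.rpow_le_rpow (by positivity) ?_ hs
      unfold weight at hxy ⊢
      linarith
    calc ‖ξ x - ξ y‖ ≤ S * dist x y * (1 + dist x x₀ + dist y x₀) ^ s := hL x y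
      _ ≤ S * dist x y * (2 ^ s * weight x₀ y ^ s) := by gcongr
      _ = (S * 2 ^ s) * (dist x y * weight x₀ y ^ s) := by ring
      _ ≤ _ := by
        gcongr
        linarith
  have hb : ∀ x, ‖ξ x‖ ≤ K * weight x₀ x ^ (s + 1) := by
    intro x
    have hp := weight_pos x₀ x
    have hp1 : 1 ≤ weight x₀ x ^ (s + 1) := Real.one_le_rpow (one_le_weight x₀ x) (by linarith)
    have hd : dist x₀ x ≤ weight x₀ x := by unfold weight; rw [dist_comm]; linarith
    have h1 : ‖ξ x₀ - ξ x‖ ≤ S * 2 ^ s * weight x₀ x ^ (s + 1) := by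
      have h2 : (1 + dist x₀ x₀ + dist x x₀) ^ s ≤ 2 ^ s * weight x₀ x ^ s := by
        rw [dist_self, add_zero]
        change weight x₀ x ^ s ≤ _
        have : 0 ≤ weight x₀ x ^ s := by positivity
        nlinarith
      calc ‖ξ x₀ - ξ x‖ ≤ S * dist x₀ x * (1 + dist x₀ x₀ + dist x x₀) ^ s := hL x₀ x
        _ ≤ S * weight x₀ x * (2 ^ s * weight x₀ x ^ s) := by gcongr
        _ = _ := by rw [Real.rpow_add hp, Real.rpow_one]; ring
    have h3 : ‖ξ x‖ ≤ ‖ξ x₀‖ + ‖ξ x₀ - ξ x‖ := by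
      have := _root_.norm_sub_le (ξ x₀) (ξ x₀ - ξ x)
      simpa using this
    have h4 := mul_le_mul_of_nonneg_left hp1 hn0
    rw [hK]
    nlinarith
  have hα' : ∀ x y, weight x₀ x ≤ weight x₀ y →
      ‖ξ x - ξ y‖ ^ α ≤ K * (dist x y ^ α * weight x₀ y ^ (α * s)) := by
    intro x y hxy
    have hq := weight_pos x₀ y
    calc ‖ξ x - ξ y‖ ^ α ≤ (K * (dist x y * weight x₀ y ^ s)) ^ α :=
          Real.rpow_le_rpow (norm_nonneg _) (hd1 x y hxy) hα.le
      _ = K ^ α * (dist x y ^ α * weight x₀ y ^ (α * s)) := by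
        rw [Real.mul_rpow (by linarith) (by positivity), Real.mul_rpow dist_nonneg (by positivity),
          ← Real.rpow_mul hq.le, mul_comm s α]
      _ ≤ _ := by
        gcongr
        exact Real.rpow_le_self_of_one_le hK1 hα1
  -- The constant is dictated by the last bound, where `K` from the `α`-th power meets `2K` from the
  -- crude size of the difference.
  refine ⟨2 * K * K, by nlinarith, fun x => (hb x).trans ?_, fun x y hxy => (hα' x y hxy).trans ?_,
    fun x y hxy => ?_⟩
  · have := weight_pos x₀ x
    gcongr
    nlinarith
  · have := weight_pos x₀ y
    gcongr
    nlinarith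
  · have hq := weight_pos x₀ y
    have hq1 := one_le_weight x₀ y
    have h1 : ‖ξ x - ξ y‖ ≤ 2 * K * weight x₀ y ^ (s + 1) := by
      have h2 : weight x₀ x ^ (s + 1) ≤ weight x₀ y ^ (s + 1) :=
        Real.rpow_le_rpow (weight_pos x₀ x).le hxy (by linarith)
      have h3 := _root_.norm_sub_le (ξ x) (ξ y)
      have h4 := hb x
      have h5 := hb y
      nlinarith
    -- The complementary power of the difference is estimated by growth alone; bounding it by the
    -- full power `s + 1` is enough for a multiplier of order `s + 1`.
    have h2 : ‖ξ x - ξ y‖ ^ (1 - α) ≤ 2 * K * weight x₀ y ^ (s + 1) := by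
      have hw : 1 ≤ weight x₀ y ^ (s + 1) := Real.one_le_rpow hq1 (by linarith)
      refine (Real.rpow_le_rpow (norm_nonneg _) h1 (by linarith)).trans ?_
      exact Real.rpow_le_self_of_one_le (by nlinarith) (by linarith)
    calc ‖ξ x - ξ y‖ = ‖ξ x - ξ y‖ ^ α * ‖ξ x - ξ y‖ ^ (1 - α) := by
          rw [← Real.rpow_add_of_nonneg (norm_nonneg _) hα.le (by linarith)]
          simp
      _ ≤ (K * (dist x y ^ α * weight x₀ y ^ (α * s))) * (2 * K * weight x₀ y ^ (s + 1)) :=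
          mul_le_mul (hα' x y hxy) h2 (by positivity) (by positivity)
      _ = _ := by rw [Real.rpow_add hq (s + 1)]; ring

variable {K : ℝ}

lemma PhaseBound.abs_inner_le (hξ : PhaseBound x₀ α s K ξ) (t : EuclideanSpace ℝ (Fin d)) (x : E) :
    |inner ℝ t (ξ x)| ≤ ‖t‖ * (K * weight x₀ x ^ (s + 1)) :=
  (abs_real_inner_le_norm _ _).trans (mul_le_mul_of_nonneg_left (hξ.norm_le x) (norm_nonneg t))

/-- The exponent `η = α` is the right one here: the difference costs exactly `d^α p^{αs}`, with no
positive order, and keeps the small factor `|t|^α`. -/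
lemma PhaseBound.norm_phase_sub_le (hξ : PhaseBound x₀ α s K ξ) (hα : 0 < α) (hα1 : α ≤ 1)
    (t : EuclideanSpace ℝ (Fin d)) (x y : E) (hxy : weight x₀ x ≤ weight x₀ y) :
    ‖phase ξ t x - phase ξ t y‖ ≤
      2 * K * ‖t‖ ^ α * (dist x y ^ α * weight x₀ y ^ (0 + α * s)) := by
  refine (norm_exp_mul_I_sub_exp_mul_I_le _ _ hα.le hα1).trans ?_
  rw [← inner_sub_right, zero_add]
  calc 2 * |inner ℝ t (ξ x - ξ y)| ^ α ≤ 2 * (‖t‖ * ‖ξ x - ξ y‖) ^ α := by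
        gcongr
        exact abs_real_inner_le_norm _ _
    _ = 2 * ‖t‖ ^ α * ‖ξ x - ξ y‖ ^ α := by
        rw [Real.mul_rpow (norm_nonneg _) (norm_nonneg _)]; ring
    _ ≤ 2 * ‖t‖ ^ α * (K * (dist x y ^ α * weight x₀ y ^ (α * s))) := by
        gcongr
        exact hξ.norm_sub_rpow_le x y hxy
    _ = _ := by ring

lemma PhaseBound.isSymbol_phase (hξ : PhaseBound x₀ α s K ξ) (hα : 0 < α) (hα1 : α ≤ 1)
    (t : EuclideanSpace ℝ (Fin d)) :
    IsSymbol x₀ α s 0 (1 + 2 * K * ‖t‖ ^ α) (phase ξ t) where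
  nonneg := by have := hξ.one_le; positivity
  norm_le x := by
    have := hξ.one_le
    rw [norm_phase, Real.rpow_zero, mul_one]
    have : 0 ≤ 2 * K * ‖t‖ ^ α := by positivity
    linarith
  norm_sub_le x y hxy := by
    refine (hξ.norm_phase_sub_le hα hα1 t x y hxy).trans ?_
    have := weight_pos x₀ y
    gcongr
    linarith

/-- A factor `|h|^η` is bought at the price of order `η(s+1)`, as small as desired. The Hölder part
already has the factor `|h|^α ≤ |h|^η`. -/
lemma PhaseBound.isSymbol_phase_sub_one (hξ : PhaseBound x₀ α s K ξ) (hα : 0 < α) (hα1 : α ≤ 1)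
    (hs : 0 ≤ s) {η : ℝ} (hη0 : 0 ≤ η) (hηα : η ≤ α) (h : EuclideanSpace ℝ (Fin d))
    (hh : ‖h‖ ≤ 1) :
    IsSymbol x₀ α s (η * (s + 1)) (2 * K * ‖h‖ ^ η) (fun x => phase ξ h x - 1) where
  nonneg := by have := hξ.one_le; positivity
  norm_le x := by
    have hK := hξ.one_le
    have hp := weight_pos x₀ x
    calc ‖phase ξ h x - 1‖ ≤ 2 * |inner ℝ h (ξ x)| ^ η :=
          norm_exp_mul_I_sub_one_le _ hη0 (hηα.trans hα1)
      _ ≤ 2 * (‖h‖ * (K * weight x₀ x ^ (s + 1))) ^ η := by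
          gcongr
          exact hξ.abs_inner_le h x
      _ = 2 * (K ^ η * ‖h‖ ^ η) * weight x₀ x ^ (η * (s + 1)) := by
          rw [Real.mul_rpow (norm_nonneg _) (by positivity), Real.mul_rpow (by positivity)
            (by positivity), ← Real.rpow_mul hp.le, mul_comm (s + 1)]
          ring
      _ ≤ 2 * (K * ‖h‖ ^ η) * weight x₀ x ^ (η * (s + 1)) := by
          gcongr
          exact Real.rpow_le_self_of_one_le hK (hηα.trans hα1)
      _ = _ := by ring
  norm_sub_le x y hxy := by
    have hK := hξ.one_le
    have hq := weight_pos x₀ y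
    rw [sub_sub_sub_cancel_right]
    refine (hξ.norm_phase_sub_le hα hα1 h x y hxy).trans ?_
    have h1 : ‖h‖ ^ α ≤ ‖h‖ ^ η := by
      rcases (norm_nonneg h).eq_or_lt with h0 | h0
      · rw [← h0, Real.zero_rpow hα.ne']; positivity
      · exact Real.rpow_le_rpow_of_exponent_ge h0 hh hηα
    have h2 : 0 ≤ η * (s + 1) := by positivity
    have := one_le_weight x₀ y
    gcongr

lemma PhaseBound.norm_inner_sub_le (hξ : PhaseBound x₀ α s K ξ)
    (h : EuclideanSpace ℝ (Fin d)) (x y : E) (hxy : weight x₀ x ≤ weight x₀ y) :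
    |inner ℝ h (ξ x) - inner ℝ h (ξ y)| ≤
      K * ‖h‖ * (dist x y ^ α * weight x₀ y ^ (s + 1 + α * s)) := by
  rw [← inner_sub_right]
  refine (abs_real_inner_le_norm _ _).trans ?_
  have := mul_le_mul_of_nonneg_left (hξ.norm_sub_le x y hxy) (norm_nonneg h)
  linarith

/-- This is the factor produced by one derivative in `t`; its order `s + 1` is the loss `(s+1)/α` in
`γ` per derivative. -/
lemma PhaseBound.isSymbol_inner (hξ : PhaseBound x₀ α s K ξ) (h : EuclideanSpace ℝ (Fin d)) :
    IsSymbol x₀ α s (s + 1) (K * ‖h‖) (fun x => ((inner ℝ h (ξ x) : ℝ) : ℂ) * Complex.I) where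
  nonneg := by have := hξ.one_le; positivity
  norm_le x := by
    rw [norm_mul, Complex.norm_I, mul_one, Complex.norm_real, Real.norm_eq_abs]
    have := hξ.abs_inner_le h x
    linarith
  norm_sub_le x y hxy := by
    rw [← sub_mul, ← Complex.ofReal_sub, norm_mul, Complex.norm_I, mul_one, Complex.norm_real,
      Real.norm_eq_abs]
    exact hξ.norm_inner_sub_le h x y hxy

/-- The first order Taylor remainder is `O(|h|^{1+η})`, hence `o(|h|)`, for an order only `η(s+1)`
above that of the derivative. -/
lemma PhaseBound.isSymbol_expRem (hξ : PhaseBound x₀ α s K ξ) (hs : 0 ≤ s) {η : ℝ}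
    (hη0 : 0 ≤ η) (hη1 : η ≤ 1) (h : EuclideanSpace ℝ (Fin d)) :
    IsSymbol x₀ α s ((s + 1) + η * (s + 1)) (8 * K * K * (‖h‖ * ‖h‖ ^ η))
      (fun x => expRem (inner ℝ h (ξ x))) := by
  have hK := hξ.one_le
  have hu : ∀ x y, weight x₀ x ≤ weight x₀ y →
      |inner ℝ h (ξ x)| ≤ ‖h‖ * (K * weight x₀ y ^ (s + 1)) := fun x y hxy => by
    have := weight_pos x₀ x
    refine (hξ.abs_inner_le h x).trans ?_
    gcongr
  have hpow : ∀ (c : ℝ) (y : E), 1 ≤ c →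
      (‖h‖ * (c * weight x₀ y ^ (s + 1))) ^ η ≤ c * (‖h‖ ^ η * weight x₀ y ^ (η * (s + 1))) := by
    intro c y hc
    have hq := weight_pos x₀ y
    rw [Real.mul_rpow (norm_nonneg _) (by positivity), Real.mul_rpow (by positivity)
      (by positivity), ← Real.rpow_mul hq.le, mul_comm (s + 1) η]
    have := Real.rpow_le_self_of_one_le hc hη1
    calc _ = c ^ η * (‖h‖ ^ η * weight x₀ y ^ (η * (s + 1))) := by ring
      _ ≤ _ := by gcongr
  refine ⟨by positivity, fun x => ?_, fun x y hxy => ?_⟩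
  · have hp := weight_pos x₀ x
    have hux := hu x x le_rfl
    calc ‖expRem (inner ℝ h (ξ x))‖ ≤ 2 * (|inner ℝ h (ξ x)| * |inner ℝ h (ξ x)| ^ η) :=
          norm_expRem_le _ hη0 hη1
      _ ≤ 2 * ((‖h‖ * (K * weight x₀ x ^ (s + 1))) *
            (K * (‖h‖ ^ η * weight x₀ x ^ (η * (s + 1))))) := by
          gcongr
          exact (Real.rpow_le_rpow (abs_nonneg _) hux hη0).trans (hpow K x hK)
      _ = 2 * K * K * (‖h‖ * ‖h‖ ^ η) * weight x₀ x ^ (s + 1 + η * (s + 1)) := by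
          rw [Real.rpow_add hp (s + 1)]; ring
      _ ≤ _ := by
          gcongr
          norm_num
  · have hq := weight_pos x₀ y
    have huv : |inner ℝ h (ξ x) - inner ℝ h (ξ y)| ≤ ‖h‖ * (2 * K * weight x₀ y ^ (s + 1)) := by
      have h1 := abs_sub (inner ℝ h (ξ x)) (inner ℝ h (ξ y))
      have h2 := hu x y hxy
      have h3 := hu y y le_rfl
      linarith
    have h1 : |inner ℝ h (ξ x) - inner ℝ h (ξ y)| ^ η + |inner ℝ h (ξ y)| ^ η ≤
        4 * K * (‖h‖ ^ η * weight x₀ y ^ (η * (s + 1))) := by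
      have h2 := (Real.rpow_le_rpow (abs_nonneg _) huv hη0).trans (hpow (2 * K) y (by linarith))
      have h3 := (Real.rpow_le_rpow (abs_nonneg _) (hu y y le_rfl) hη0).trans (hpow K y hK)
      have h4 : 0 ≤ K * (‖h‖ ^ η * weight x₀ y ^ (η * (s + 1))) := by positivity
      linarith
    calc ‖expRem (inner ℝ h (ξ x)) - expRem (inner ℝ h (ξ y))‖
        ≤ 2 * |inner ℝ h (ξ x) - inner ℝ h (ξ y)| *
          (|inner ℝ h (ξ x) - inner ℝ h (ξ y)| ^ η + |inner ℝ h (ξ y)| ^ η) :=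
          norm_expRem_sub_le _ _ hη0 hη1
      _ ≤ 2 * (K * ‖h‖ * (dist x y ^ α * weight x₀ y ^ (s + 1 + α * s))) *
          (4 * K * (‖h‖ ^ η * weight x₀ y ^ (η * (s + 1)))) := by
          gcongr
          exact hξ.norm_inner_sub_le h x y hxy
      _ = _ := by
          rw [show s + 1 + η * (s + 1) + α * s = (s + 1 + α * s) + η * (s + 1) by ring,
            Real.rpow_add hq _ (η * (s + 1))]
          ring

/-- Multiplication by `e^{i⟨t, ξ⟩}` depends continuously on `t`, as an operator from
`𝓑_{α,β,γ}` to a larger space `𝓑_{α,β,γ'}`. -/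
lemma PhaseBound.continuous_mulOp (hξ : PhaseBound x₀ α s K ξ) (hα : 0 < α) (hα1 : α ≤ 1)
    (hs : 0 ≤ s) (hβ : s + 1 ≤ β) (hβγ : β ≤ γ) (hγγ' : γ < γ')
    (T : EuclideanSpace ℝ (Fin d) → (WHolder x₀ α β γ →L[ℂ] WHolder x₀ α β γ'))
    (hT : ∀ t f x, T t f x = phase ξ t x * f x) : Continuous T := by
  have hs1 : 0 < s + 1 := by linarith
  have hδ : 0 < α * (γ' - γ) := mul_pos hα (by linarith)
  set η := min α (α * (γ' - γ) / (s + 1)) with hη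
  have hη0 : 0 < η := lt_min hα (by positivity)
  have hη1 : η ≤ α := min_le_left _ _
  have hη2 : η * (s + 1) ≤ α * (γ' - γ) := by
    rw [← le_div_iff₀ hs1]; exact min_le_right _ _
  rw [continuous_iff_continuousAt]
  intro t
  rw [ContinuousAt, tendsto_iff_norm_sub_tendsto_zero]
  set C := 4 * (2 * ((1 + 2 * K * ‖t‖ ^ α) * (2 * K)))
  have hlim : Tendsto (fun t' => C * ‖t' - t‖ ^ η) (𝓝 t) (𝓝 0) := by
    have hc : Continuous fun t' : EuclideanSpace ℝ (Fin d) => C * ‖t' - t‖ ^ η :=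
      continuous_const.mul
        ((continuous_id.sub continuous_const).norm.rpow_const fun _ => Or.inr hη0.le)
    have := hc.tendsto t
    simpa [Real.zero_rpow hη0.ne'] using this
  refine squeeze_zero' (Eventually.of_forall fun _ => norm_nonneg _) ?_ hlim
  filter_upwards [Metric.ball_mem_nhds t one_pos] with t' ht'
  have ht1 : ‖t' - t‖ ≤ 1 := by rw [← dist_eq_norm]; exact (Metric.mem_ball.1 ht').le
  have hsym := (hξ.isSymbol_phase hα hα1 t).mul
    (hξ.isSymbol_phase_sub_one hα hα1 hs hη0.le hη1 (t' - t) ht1) le_rfl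
  refine (norm_le_of_mulOp (γ' := γ') hsym hα hβ hβγ (by linarith) (T t' - T t)
    fun f x => ?_).trans (le_of_eq ?_)
  · rw [_root_.sub_apply, WHolder.sub_apply, hT, hT,
      show phase ξ t' x = phase ξ t x * phase ξ (t' - t) x by rw [← phase_add]; congr 1; abel]
    ring
  · simp only [C]; ring

/-- Multiplication by `e^{i⟨t, ξ⟩}` is of class `𝒞^n` in `t`, as an operator from
`𝓑_{α,β,γ}` to `𝓑_{α,β,γ'}`, when `γ' > γ + n(s+1)/α`. -/
theorem PhaseBound.contDiff_mulOp (hξ : PhaseBound x₀ α s K ξ) (hα : 0 < α) (hα1 : α ≤ 1)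
    (hs : 0 ≤ s) (hβ : s + 1 ≤ β) (hβγ : β ≤ γ) (n : ℕ) :
    ∀ {γ' : ℝ}, α * γ + n * (s + 1) < α * γ' →
    ∀ T : EuclideanSpace ℝ (Fin d) → (WHolder x₀ α β γ →L[ℂ] WHolder x₀ α β γ'),
    (∀ t f x, T t f x = phase ξ t x * f x) → ContDiff ℝ n T := by
  have hs1 : 0 < s + 1 := by linarith
  induction n with
  | zero =>
    intro γ' h T hT
    have hγγ' : γ < γ' := by
      refine lt_of_mul_lt_mul_left (a := α) ?_ hα.le
      simpa using h
    exact contDiff_zero.2 (hξ.continuous_mulOp hα hα1 hs hβ hβγ hγγ' T hT)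
  | succ n ih =>
    intro γ' h T hT
    push_cast at h
    -- The last multiplication, by `i⟨h,ξ⟩`, uses exactly `s + 1`; all of the strict slack is left
    -- to the induction hypothesis between `γ` and `γ₁`.
    set γ₁ := γ' - (s + 1) / α with hγ₁
    have hαγ₁ : α * γ₁ + (s + 1) = α * γ' := by rw [hγ₁]; field_simp; ring
    have hn : 0 ≤ (n : ℝ) * (s + 1) := by positivity
    have hγγ₁ : γ ≤ γ₁ := le_of_mul_le_mul_left (a := α) (by nlinarith) hα
    choose T₁ hT₁ _ using fun t => (hξ.isSymbol_phase hα hα1 t).exists_mulOp (γ := γ) (γ' := γ₁)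
      hα hβ hβγ (by nlinarith)
    choose N hN _ using fun h => (hξ.isSymbol_inner h).exists_mulOp (γ := γ₁) (γ' := γ')
      hα hβ (hβγ.trans hγγ₁) hαγ₁.le
    have hT₁C : ContDiff ℝ n T₁ := ih (by linarith) T₁ hT₁
    -- The candidate derivative multiplies by `i⟨h,ξ⟩ e^{i⟨t,ξ⟩}`, factored through `𝓑_{α,β,γ₁}`.
    -- Continuity in `h` is automatic in finite dimension.
    let T' : EuclideanSpace ℝ (Fin d) → EuclideanSpace ℝ (Fin d) →L[ℝ]
        (WHolder x₀ α β γ →L[ℂ] WHolder x₀ α β γ') := fun t => LinearMap.toContinuousLinearMap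
      { toFun := fun h => (N h).comp (T₁ t)
        map_add' := fun h h' => by
          ext1 f
          refine WHolder.ext_fun fun x => ?_
          simp [hN, inner_add_left]
          ring
        map_smul' := fun c h => by
          ext1 f
          refine WHolder.ext_fun fun x => ?_
          change N (c • h) (T₁ t f) x = ((c : ℂ) • N h (T₁ t f)) x
          rw [WHolder.smul_apply, hN, hN, inner_smul_left]
          push_cast
          simp
          ring }
    refine contDiff_succ_iff_hasFDerivAt.2 ⟨T', ?_, fun t => ?_⟩
    -- Since `h` ranges over a finite-dimensional space, regularity of `t ↦ T' t h` for each fixed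
    -- `h` suffices.
    · rw [contDiff_clm_apply_iff]
      intro h
      exact (((ContinuousLinearMap.compL ℂ (WHolder x₀ α β γ) (WHolder x₀ α β γ₁)
        (WHolder x₀ α β γ') (N h)).restrictScalars ℝ).contDiff).comp hT₁C
    -- Chosen so that the order `(1+η)(s+1)` of the remainder fits between `αγ` and `αγ'`.
    · set η := min 1 ((α * γ' - α * γ - (s + 1)) / (s + 1)) with hη
      have hη0 : 0 < η := lt_min one_pos (div_pos (by linarith) hs1)
      have hη1 : η ≤ 1 := min_le_left _ _
      have hη2 : η * (s + 1) ≤ α * γ' - α * γ - (s + 1) := by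
        rw [← le_div_iff₀ hs1]; exact min_le_right _ _
      rw [hasFDerivAt_iff_isLittleO_nhds_zero, Asymptotics.isLittleO_iff]
      intro c hc
      set C := 4 * (2 * ((1 + 2 * K * ‖t‖ ^ α) * (8 * K * K)))
      have hlim : Tendsto (fun h : EuclideanSpace ℝ (Fin d) => C * ‖h‖ ^ η) (𝓝 0) (𝓝 0) := by
        have hcont : Continuous fun h : EuclideanSpace ℝ (Fin d) => C * ‖h‖ ^ η :=
          continuous_const.mul (continuous_norm.rpow_const fun _ => Or.inr hη0.le)
        have := hcont.tendsto 0
        simpa [Real.zero_rpow hη0.ne'] using this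
      filter_upwards [hlim.eventually (eventually_lt_nhds hc)] with h hh
      have hsym := (hξ.isSymbol_phase hα hα1 t).mul
        (hξ.isSymbol_expRem hs hη0.le hη1 h) le_rfl
      refine (norm_le_of_mulOp (γ' := γ') hsym hα hβ hβγ (by linarith)
        (T (t + h) - T t - T' t h) fun f x => ?_).trans ?_
      · change (T (t + h) f - T t f - N h (T₁ t f)) x = _
        rw [WHolder.sub_apply, WHolder.sub_apply, hT, hT, hN, hT₁, phase_add]
        simp only [expRem, phase]
        ring
      · calc 4 * (2 * ((1 + 2 * K * ‖t‖ ^ α) * (8 * K * K * (‖h‖ * ‖h‖ ^ η))))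
            = C * ‖h‖ ^ η * ‖h‖ := by simp only [C]; ring
          _ ≤ c * ‖h‖ := mul_le_mul_of_nonneg_right hh.le (norm_nonneg h)

end Phase

/-! ### Integrals of invariant measures -/

section Drift

/-- A geometric drift condition bounds the mass given by any invariant probability measure. -/
lemma lintegral_ne_top_of_drift {E : Type*} [MeasurableSpace E] {Q : Kernel E E} [IsMarkovKernel Q]
    {π : Measure E} [IsProbabilityMeasure π] (hπ : Kernel.Invariant Q π) {W : E → ℝ}
    (hW : Measurable W) (hW0 : ∀ x, 0 ≤ W x) {ρ B : ℝ} (hρ0 : 0 ≤ ρ) (hρ1 : ρ < 1) (hB : 0 ≤ B)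
    (hdrift : ∀ x, ∫⁻ y, ENNReal.ofReal (W y) ∂(Q x) ≤ ENNReal.ofReal (ρ * W x + B)) :
    ∫⁻ x, ENNReal.ofReal (W x) ∂π ≠ ⊤ := by
  have hinv : ∀ f : E → ENNReal, Measurable f → ∫⁻ x, ∫⁻ y, f y ∂(Q x) ∂π = ∫⁻ x, f x ∂π := by
    intro f hf
    conv_rhs => rw [← hπ.def]
    rw [Measure.lintegral_bind Q.measurable.aemeasurable hf.aemeasurable]
  -- `W` is truncated at `N` because invariance cancels `π(min(W,N))` from both sides only once it
  -- is known to be finite.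
  have key : ∀ N : ℕ, ∫⁻ x, {x | W x ≤ N}.indicator
      (fun x => ENNReal.ofReal ((1 - ρ) * W x)) x ∂π ≤ ENNReal.ofReal B := by
    intro N
    have hS : MeasurableSet {x | W x ≤ N} := measurableSet_le hW measurable_const
    have hg : Measurable ({x | W x ≤ N}.indicator fun x => ENNReal.ofReal ((1 - ρ) * W x)) :=
      (hW.const_mul _).ennreal_ofReal.indicator hS
    have hfm : Measurable fun x => ENNReal.ofReal (min (W x) N) :=
      (hW.min measurable_const).ennreal_ofReal
    have hfin : ∫⁻ x, ENNReal.ofReal (min (W x) N) ∂π ≠ ⊤ := by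
      refine ne_top_of_le_ne_top (b := ENNReal.ofReal N) ENNReal.ofReal_ne_top ?_
      calc _ ≤ ∫⁻ _, ENNReal.ofReal N ∂π :=
            lintegral_mono fun x => ENNReal.ofReal_le_ofReal (min_le_right _ _)
        _ = _ := by simp
    -- Where `W ≤ N` this is the drift inequality with `(1-ρ)W` moved to the left; elsewhere the
    -- truncation alone gives `N`.
    have hpt : ∀ x, (∫⁻ y, ENNReal.ofReal (min (W y) N) ∂(Q x)) +
        {x | W x ≤ N}.indicator (fun x => ENNReal.ofReal ((1 - ρ) * W x)) x ≤
        ENNReal.ofReal (min (W x) N) + ENNReal.ofReal B := by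
      intro x
      have hNn : (0 : ℝ) ≤ N := N.cast_nonneg
      have h1 : ∫⁻ y, ENNReal.ofReal (min (W y) N) ∂(Q x) ≤ ENNReal.ofReal (ρ * W x + B) :=
        (lintegral_mono fun y => ENNReal.ofReal_le_ofReal (min_le_left _ _)).trans (hdrift x)
      have h2 : ∫⁻ y, ENNReal.ofReal (min (W y) N) ∂(Q x) ≤ ENNReal.ofReal N := by
        calc _ ≤ ∫⁻ _, ENNReal.ofReal N ∂(Q x) :=
              lintegral_mono fun x => ENNReal.ofReal_le_ofReal (min_le_right _ _)
          _ = _ := by simp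
      by_cases hx : W x ≤ N
      · rw [Set.indicator_of_mem (show x ∈ {x | W x ≤ N} from hx), min_eq_left hx]
        have h0 := mul_nonneg hρ0 (hW0 x)
        refine (add_le_add_left h1 _).trans (le_of_eq ?_)
        rw [← ENNReal.ofReal_add (by linarith) (mul_nonneg (by linarith) (hW0 x)),
          ← ENNReal.ofReal_add (hW0 x) hB]
        congr 1; ring
      · rw [Set.indicator_of_notMem (show x ∉ {x | W x ≤ N} from hx), min_eq_right (by linarith),
          add_zero]
        exact h2.trans le_self_add
    have hint := lintegral_mono (μ := π) hpt
    rw [lintegral_add_right _ hg, lintegral_add_left hfm, hinv _ hfm, lintegral_const,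
      measure_univ, mul_one] at hint
    exact (ENNReal.add_le_add_iff_left hfin).1 hint
  -- The bound is uniform in `N`, so monotone convergence removes the truncation.
  have hlim : ∫⁻ x, ENNReal.ofReal ((1 - ρ) * W x) ∂π ≤ ENNReal.ofReal B := by
    have hmono := lintegral_iSup (μ := π)
      (f := fun (N : ℕ) => {x | W x ≤ N}.indicator fun x => ENNReal.ofReal ((1 - ρ) * W x))
      (fun N => (hW.const_mul _).ennreal_ofReal.indicator
        (measurableSet_le hW measurable_const))
      (fun N M hNM => Set.indicator_le_indicator_of_subset
        (fun x (hx : W x ≤ N) => hx.trans (Nat.cast_le.2 hNM)) (fun _ => zero_le))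
    have hsup : ∀ x, ENNReal.ofReal ((1 - ρ) * W x) ≤ ⨆ N : ℕ,
        {x | W x ≤ N}.indicator (fun x => ENNReal.ofReal ((1 - ρ) * W x)) x := by
      intro x
      obtain ⟨N, hN⟩ := exists_nat_ge (W x)
      refine le_iSup_of_le N ?_
      rw [Set.indicator_of_mem (show x ∈ {x | W x ≤ N} from hN)]
    exact (lintegral_mono hsup).trans (hmono.le.trans (iSup_le key))
  have h1ρ : 0 ≤ 1 - ρ := by linarith
  simp_rw [ENNReal.ofReal_mul h1ρ] at hlim
  rw [lintegral_const_mul _ hW.ennreal_ofReal] at hlim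
  intro htop
  rw [htop, ENNReal.mul_top (by simpa using hρ1)] at hlim
  exact absurd hlim (by simp)

/-- Dominated convergence, with the value at `l = 1` as dominating function. It makes a small
additive perturbation harmless, both for the factor of `p_l` and for the drift of `π`. -/
lemma tendsto_integral_mul_add_rpow {G : Type*} [MeasurableSpace G] {μ : Measure G}
    {w u v : G → ℝ} (hw : Measurable w) (hu : Measurable u) (hv : Measurable v)
    (hw0 : ∀ g, 0 ≤ w g) (hu0 : ∀ g, 0 ≤ u g) (hv0 : ∀ g, 0 ≤ v g) {q : ℝ} (hq : 0 ≤ q)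
    (hint : Integrable (fun g => w g * (u g + v g) ^ q) μ) :
    Tendsto (fun l => ∫ g, w g * (u g + l * v g) ^ q ∂μ) (𝓝[>] 0) (𝓝 (∫ g, w g * u g ^ q ∂μ)) := by
  refine tendsto_integral_filter_of_dominated_convergence (fun g => w g * (u g + v g) ^ q)
    (Eventually.of_forall fun l => ?_) ?_ hint (Eventually.of_forall fun g => ?_)
  · exact (hw.mul ((hu.add (hv.const_mul l)).pow_const q)).aestronglyMeasurable
  · filter_upwards [Ioc_mem_nhdsGT one_pos] with l hl
    refine Eventually.of_forall fun g => ?_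
    have h1 : 0 ≤ l * v g := mul_nonneg hl.1.le (hv0 g)
    have h2 : l * v g ≤ v g := mul_le_of_le_one_left (hv0 g) hl.2
    have h3 := hu0 g
    have h4 := hw0 g
    rw [Real.norm_of_nonneg (by positivity)]
    gcongr
  · have hc : Continuous fun l : ℝ => w g * (u g + l * v g) ^ q :=
      continuous_const.mul ((by fun_prop : Continuous fun l : ℝ => u g + l * v g).rpow_const
        fun _ => Or.inr hq)
    have := hc.tendsto 0
    simp only [zero_mul, add_zero] at this
    exact this.mono_left nhdsWithin_le_nhds

end Drift

/-! ### Lipschitz models -/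

namespace LipschitzModel

variable {E : Type u} [MetricSpace E] [MeasurableSpace E] {G : Type v} [MeasurableSpace G]
  (𝓜 : LipschitzModel E G)

lemma bddAbove_lipQuot (g : G) : BddAbove (Set.range fun z : {z : E × E // z.1 ≠ z.2} =>
    dist (𝓜.F z.1.1 g) (𝓜.F z.1.2 g) / dist z.1.1 z.1.2) := by
  obtain ⟨K, hK⟩ := 𝓜.lipschitz_F g
  refine ⟨K, ?_⟩
  rintro _ ⟨z, rfl⟩
  rw [div_le_iff₀ (dist_pos.2 z.2)]
  exact hK.dist_le_mul _ _

lemma lipC_nonneg (g : G) : 0 ≤ 𝓜.lipC g := Real.iSup_nonneg fun z => by positivity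

lemma dist_F_le (g : G) (x y : E) : dist (𝓜.F x g) (𝓜.F y g) ≤ 𝓜.lipC g * dist x y := by
  by_cases hxy : x = y
  · simp [hxy]
  · have := le_ciSup (𝓜.bddAbove_lipQuot g) ⟨(x, y), hxy⟩
    rwa [div_le_iff₀ (dist_pos.2 hxy)] at this

lemma measurable_F_right (x : E) : Measurable (𝓜.F x) :=
  𝓜.measurable_F.comp measurable_prodMk_left

lemma continuous_F_left (g : G) : Continuous fun x => 𝓜.F x g := by
  obtain ⟨K, hK⟩ := 𝓜.lipschitz_F g
  exact hK.continuous

lemma measurable_lipC [SecondCountableTopology E] [BorelSpace E] : Measurable 𝓜.lipC := by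
  obtain hZ | hZ := isEmpty_or_nonempty {z : E × E // z.1 ≠ z.2}
  · have : 𝓜.lipC = fun _ => 0 := by funext g; simp [lipC, Real.iSup_of_isEmpty]
    rw [this]; exact measurable_const
  · refine measurable_of_Iic fun c => ?_
    -- The quotient is continuous off the diagonal, so the uncountable supremum reduces to a
    -- countable dense set of pairs.
    obtain ⟨D, hDc, hDd⟩ := TopologicalSpace.exists_countable_dense {z : E × E // z.1 ≠ z.2}
    have : 𝓜.lipC ⁻¹' Set.Iic c = ⋂ z ∈ D,
        {g | dist (𝓜.F z.1.1 g) (𝓜.F z.1.2 g) / dist z.1.1 z.1.2 ≤ c} := by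
      ext g
      simp only [Set.mem_preimage, Set.mem_Iic, Set.mem_iInter, Set.mem_ofPred_eq]
      constructor
      · exact fun h z _ => (le_ciSup (𝓜.bddAbove_lipQuot g) z).trans h
      · intro h
        refine ciSup_le fun z => ?_
        have hcont : Continuous fun z : {z : E × E // z.1 ≠ z.2} =>
            dist (𝓜.F z.1.1 g) (𝓜.F z.1.2 g) / dist z.1.1 z.1.2 := by
          have hF := 𝓜.continuous_F_left g
          refine Continuous.div ?_ (by fun_prop) fun z => (dist_pos.2 z.2).ne'
          exact (hF.comp (by fun_prop)).dist (hF.comp (by fun_prop))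
        exact (isClosed_le hcont continuous_const).closure_subset_iff.2 h (hDd z)
    rw [this]
    refine MeasurableSet.biInter hDc fun z _ => measurableSet_le ?_ measurable_const
    exact ((𝓜.measurable_F_right _).dist (𝓜.measurable_F_right _)).div_const _

lemma measurable_dist_F [SecondCountableTopology E] [BorelSpace E] (x₀ : E) :
    Measurable fun g => dist (𝓜.F x₀ g) x₀ :=
  (𝓜.measurable_F_right x₀).dist measurable_const

lemma measurable_bigM [SecondCountableTopology E] [BorelSpace E] (x₀ : E) :
    Measurable (𝓜.bigM x₀) :=
  (measurable_const.add 𝓜.measurable_lipC).add (𝓜.measurable_dist_F x₀)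

lemma one_le_bigM (x₀ : E) (g : G) : 1 ≤ 𝓜.bigM x₀ g := by
  unfold bigM
  linarith [𝓜.lipC_nonneg g, dist_nonneg (x := 𝓜.F x₀ g) (y := x₀)]

lemma dist_F_base_le (x₀ : E) (g : G) (x : E) :
    dist (𝓜.F x g) x₀ ≤ 𝓜.lipC g * dist x x₀ + dist (𝓜.F x₀ g) x₀ :=
  (dist_triangle _ (𝓜.F x₀ g) _).trans (add_le_add (𝓜.dist_F_le g x x₀) le_rfl)

lemma weight_F_le_mul (x₀ : E) (g : G) (x : E) :
    weight x₀ (𝓜.F x g) ≤ 𝓜.bigM x₀ g * weight x₀ x := by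
  have h1 := 𝓜.dist_F_base_le x₀ g x
  have h2 := 𝓜.lipC_nonneg g
  have h3 := dist_nonneg (x := x) (y := x₀)
  have h4 := dist_nonneg (x := 𝓜.F x₀ g) (y := x₀)
  unfold weight bigM
  nlinarith [mul_nonneg h4 h3]

lemma weight_F_le_add (x₀ : E) (g : G) (x : E) :
    weight x₀ (𝓜.F x g) ≤ 𝓜.lipC g * weight x₀ x + 𝓜.bigM x₀ g := by
  have h1 := 𝓜.dist_F_base_le x₀ g x
  have h2 := 𝓜.lipC_nonneg g
  unfold weight bigM
  linarith

/-- The factor by which `p_l` grows along one step of the model. -/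
def growth (x₀ : E) (l : ℝ) (g : G) : ℝ := max (𝓜.lipC g) 1 + l * dist (𝓜.F x₀ g) x₀

lemma one_le_growth (x₀ : E) {l : ℝ} (hl : 0 ≤ l) (g : G) : 1 ≤ 𝓜.growth x₀ l g := by
  unfold growth
  have := mul_nonneg hl (dist_nonneg (x := 𝓜.F x₀ g) (y := x₀))
  linarith [le_max_right (𝓜.lipC g) 1]

/-- The additive displacement `d(F(x₀,g),x₀)` enters `p_l` with a factor `l`, and `p_l ≥ 1` absorbs
it. The factor thus tends to `max{𝒞,1}` as `l → 0`. -/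
lemma scaledWeight_F_le (x₀ : E) {l : ℝ} (hl : 0 ≤ l) (g : G) (x : E) :
    scaledWeight x₀ l (𝓜.F x g) ≤ 𝓜.growth x₀ l g * scaledWeight x₀ l x := by
  have h1 := mul_le_mul_of_nonneg_left (𝓜.dist_F_base_le x₀ g x) hl
  have h3 := mul_nonneg hl (dist_nonneg (x := x) (y := x₀))
  have h4 := mul_nonneg hl (dist_nonneg (x := 𝓜.F x₀ g) (y := x₀))
  have h5 := le_max_left (𝓜.lipC g) 1
  have h6 := le_max_right (𝓜.lipC g) 1
  unfold scaledWeight growth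
  nlinarith [mul_nonneg h4 h3, mul_nonneg (sub_nonneg.2 h5) h3]

lemma scaledΔ_F_le (x₀ : E) {l a b : ℝ} (hl : 0 ≤ l) (ha : 0 ≤ a) (hb : 0 ≤ b) (g : G) (x y : E) :
    scaledΔ x₀ l a b (𝓜.F x g) (𝓜.F y g) ≤ 𝓜.growth x₀ l g ^ (a + b) * scaledΔ x₀ l a b x y := by
  have hg : 0 < 𝓜.growth x₀ l g := one_pos.trans_le (𝓜.one_le_growth x₀ hl g)
  have hp := fun z => scaledWeight_pos x₀ hl z
  have key : ∀ (z : E) (c : ℝ), 0 ≤ c → scaledWeight x₀ l (𝓜.F z g) ^ c ≤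
      𝓜.growth x₀ l g ^ c * scaledWeight x₀ l z ^ c := fun z c hc => by
    rw [← Real.mul_rpow hg.le (hp z).le]
    exact Real.rpow_le_rpow (hp _).le (𝓜.scaledWeight_F_le x₀ hl g z) hc
  have h1 : scaledWeight x₀ l (𝓜.F x g) ^ a * scaledWeight x₀ l (𝓜.F y g) ^ b ≤ _ :=
    mul_le_mul (key x a ha) (key y b hb) (Real.rpow_nonneg (hp _).le _)
      (mul_nonneg (by positivity) (Real.rpow_nonneg (hp _).le _))
  have h2 : scaledWeight x₀ l (𝓜.F x g) ^ b * scaledWeight x₀ l (𝓜.F y g) ^ a ≤ _ :=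
    mul_le_mul (key x b hb) (key y a ha) (Real.rpow_nonneg (hp _).le _)
      (mul_nonneg (by positivity) (Real.rpow_nonneg (hp _).le _))
  unfold scaledΔ
  refine (add_le_add h1 h2).trans (le_of_eq ?_)
  rw [Real.rpow_add hg]
  ring

/-- Moment and contraction properties of the model, for the weight `p_l` and for all exponents
`γ ≤ Γ`. -/
structure Contracts (x₀ : E) (α β Γ l κ : ℝ) : Prop where
  l_pos : 0 < l
  l_le_one : l ≤ 1
  κ_nonneg : 0 ≤ κ
  κ_lt_one : κ < 1
  integrable_bigM : Integrable (fun g => 𝓜.bigM x₀ g ^ (α * (Γ + 1))) 𝓜.law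
  integrable_lipC : Integrable (fun g => 𝓜.lipC g ^ α * 𝓜.growth x₀ l g ^ (α * (Γ + β))) 𝓜.law
  integral_le : ∫ g, 𝓜.lipC g ^ α * 𝓜.growth x₀ l g ^ (α * (Γ + β)) ∂𝓜.law ≤ κ

variable [SecondCountableTopology E] [BorelSpace E]

/-- For `l ≤ 1` the growth factor is at most `ℳ`, so the moment hypothesis dominates. The integral
then converges, as `l → 0`, to the one assumed `< 1`. -/
lemma exists_contracts {x₀ : E} {α β Γ : ℝ} (hα : 0 < α) (hβ : 0 ≤ β) (hΓ : 0 ≤ Γ)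
    (hmoment : ∫⁻ g, ENNReal.ofReal (𝓜.bigM x₀ g ^ (α * (Γ + 1)) +
      𝓜.lipC g ^ α * 𝓜.bigM x₀ g ^ (α * (Γ + β))) ∂𝓜.law < ⊤)
    (hcontr : ∫⁻ g, ENNReal.ofReal (𝓜.lipC g ^ α *
      max (𝓜.lipC g) 1 ^ (α * (Γ + β))) ∂𝓜.law < 1) :
    ∃ l κ, 𝓜.Contracts x₀ α β Γ l κ := by
  have hM := 𝓜.measurable_bigM x₀
  have hC := 𝓜.measurable_lipC
  have hb := 𝓜.measurable_dist_F x₀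
  have hM0 : ∀ g, 0 < 𝓜.bigM x₀ g := fun g => one_pos.trans_le (𝓜.one_le_bigM x₀ g)
  have hC0 := 𝓜.lipC_nonneg
  have hm1 : Measurable fun g => 𝓜.bigM x₀ g ^ (α * (Γ + 1)) := hM.pow_const _
  have hm2 : Measurable fun g => 𝓜.lipC g ^ α * 𝓜.bigM x₀ g ^ (α * (Γ + β)) :=
    (hC.pow_const _).mul (hM.pow_const _)
  have hn1 : ∀ g, 0 ≤ 𝓜.bigM x₀ g ^ (α * (Γ + 1)) := fun g => by have := hM0 g; positivity
  have hn2 : ∀ g, 0 ≤ 𝓜.lipC g ^ α * 𝓜.bigM x₀ g ^ (α * (Γ + β)) := fun g => by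
    have := hM0 g; have := hC0 g; positivity
  have hint : Integrable (fun g => 𝓜.bigM x₀ g ^ (α * (Γ + 1)) +
      𝓜.lipC g ^ α * 𝓜.bigM x₀ g ^ (α * (Γ + β))) 𝓜.law := by
    refine ⟨(hm1.add hm2).aestronglyMeasurable, ?_⟩
    rwa [hasFiniteIntegral_iff_ofReal (Eventually.of_forall fun g => add_nonneg (hn1 g) (hn2 g))]
  have hint1 : Integrable (fun g => 𝓜.bigM x₀ g ^ (α * (Γ + 1))) 𝓜.law :=
    hint.mono' hm1.aestronglyMeasurable (Eventually.of_forall fun g => by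
      rw [Real.norm_of_nonneg (hn1 g)]; linarith [hn2 g])
  have hint2 : Integrable (fun g => 𝓜.lipC g ^ α * 𝓜.bigM x₀ g ^ (α * (Γ + β))) 𝓜.law :=
    hint.mono' hm2.aestronglyMeasurable (Eventually.of_forall fun g => by
      rw [Real.norm_of_nonneg (hn2 g)]; linarith [hn1 g])
  have hq : 0 ≤ α * (Γ + β) := by positivity
  have hmaxm : Measurable fun g => max (𝓜.lipC g) 1 := hC.max measurable_const
  have hlt : ∫ g, 𝓜.lipC g ^ α * max (𝓜.lipC g) 1 ^ (α * (Γ + β)) ∂𝓜.law < 1 := by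
    have e := integral_eq_lintegral_of_nonneg_ae (μ := 𝓜.law)
      (f := fun g => 𝓜.lipC g ^ α * max (𝓜.lipC g) 1 ^ (α * (Γ + β)))
      (Eventually.of_forall fun g => mul_nonneg (Real.rpow_nonneg (hC0 g) _)
        (Real.rpow_nonneg (zero_le_one.trans (le_max_right _ _)) _))
      ((hC.pow_const _).mul (hmaxm.pow_const _)).aestronglyMeasurable
    rw [e]
    have := (ENNReal.toReal_lt_toReal hcontr.ne_top ENNReal.one_ne_top).2 hcontr
    simpa using this
  have hle : ∀ l, 0 ≤ l → l ≤ 1 → ∀ g, 𝓜.growth x₀ l g ≤ 𝓜.bigM x₀ g := by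
    intro l _ hl1 g
    have h1 : max (𝓜.lipC g) 1 ≤ 1 + 𝓜.lipC g := max_le (by linarith) (by linarith [hC0 g])
    have h2 := mul_le_of_le_one_left (dist_nonneg (x := 𝓜.F x₀ g) (y := x₀)) hl1
    unfold growth bigM
    linarith
  have hgm : ∀ l, Measurable fun g => 𝓜.lipC g ^ α * 𝓜.growth x₀ l g ^ (α * (Γ + β)) := fun l =>
    (hC.pow_const _).mul ((hmaxm.add (hb.const_mul l)).pow_const _)
  have hgi : ∀ l, 0 ≤ l → l ≤ 1 →
      Integrable (fun g => 𝓜.lipC g ^ α * 𝓜.growth x₀ l g ^ (α * (Γ + β))) 𝓜.law := by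
    intro l hl hl1
    refine hint2.mono' (hgm l).aestronglyMeasurable (Eventually.of_forall fun g => ?_)
    have h1 := hC0 g
    have h2 : 0 ≤ 𝓜.growth x₀ l g := zero_le_one.trans (𝓜.one_le_growth x₀ hl g)
    have h3 := hle l hl hl1 g
    rw [Real.norm_of_nonneg (by positivity)]
    gcongr
  have hlim := tendsto_integral_mul_add_rpow (μ := 𝓜.law) (hC.pow_const α) hmaxm hb
    (fun g => Real.rpow_nonneg (hC0 g) _) (fun g => zero_le_one.trans (le_max_right _ _))
    (fun g => dist_nonneg) hq (by simpa [growth] using hgi 1 zero_le_one le_rfl)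
  obtain ⟨l, hl, hl1⟩ := ((hlim.eventually (eventually_lt_nhds hlt)).and
    (Ioc_mem_nhdsGT one_pos)).exists
  -- `κ` is the integral itself for the chosen `l`.
  exact ⟨l, _, hl1.1, hl1.2, integral_nonneg fun g => by
    have h1 := hC0 g
    have h2 : 0 ≤ 𝓜.growth x₀ l g := zero_le_one.trans (𝓜.one_le_growth x₀ hl1.1.le g)
    positivity, hl, hint1, hgi l hl1.1.le hl1.2, le_rfl⟩

end LipschitzModel

/-! ### The transition kernel on weighted Hölder functions, and moments of `π` -/

namespace LipschitzModel

section KernelAction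

variable {E : Type u} [MetricSpace E] [MeasurableSpace E] {G : Type v} [MeasurableSpace G]
  (𝓜 : LipschitzModel E G)

lemma kernel_apply (x : E) : 𝓜.kernel x = 𝓜.law.map (𝓜.F x) := rfl

instance isMarkovKernel_kernel : IsMarkovKernel 𝓜.kernel :=
  ⟨fun x => by
    rw [kernel_apply]
    exact Measure.isProbabilityMeasure_map (𝓜.measurable_F_right x).aemeasurable⟩

lemma integral_kernel {f : E → ℂ} (hf : Measurable f) (x : E) :
    ∫ y, f y ∂(𝓜.kernel x) = ∫ g, f (𝓜.F x g) ∂𝓜.law := by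
  rw [kernel_apply]
  exact integral_map (𝓜.measurable_F_right x).aemeasurable hf.aestronglyMeasurable

lemma integrable_kernel_iff {f : E → ℂ} (hf : Measurable f) (x : E) :
    Integrable f (𝓜.kernel x) ↔ Integrable (fun g => f (𝓜.F x g)) 𝓜.law := by
  rw [kernel_apply]
  exact integrable_map_measure hf.aestronglyMeasurable (𝓜.measurable_F_right x).aemeasurable

end KernelAction

namespace Contracts

variable {E : Type u} [MetricSpace E] [MeasurableSpace E] {G : Type v} [MeasurableSpace G] {𝓜 : LipschitzModel E G} {x₀ : E}
  {α β γ Γ l κ : ℝ}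

/-- Since `ℳ ≥ 1`, its moment of order `α(Γ+1)` serves every exponent `γ ≤ Γ`. -/
lemma norm_comp_F_le (hα : 0 < α) (hγ : 0 ≤ γ) (hγΓ : γ ≤ Γ) {B : ℝ} (hB : 0 ≤ B) {f : E → ℂ}
    (hf : ∀ x, ‖f x‖ ≤ B * weight x₀ x ^ (α * (γ + 1))) (x : E) (g : G) :
    ‖f (𝓜.F x g)‖ ≤
      B * weight x₀ x ^ (α * (γ + 1)) * 𝓜.bigM x₀ g ^ (α * (Γ + 1)) := by
  have hp := weight_pos x₀ x
  have hp' := weight_pos x₀ (𝓜.F x g)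
  have hM1 := 𝓜.one_le_bigM x₀ g
  have hM : 0 < 𝓜.bigM x₀ g := by linarith
  have hr : 0 ≤ α * (γ + 1) := by positivity
  calc ‖f (𝓜.F x g)‖ ≤ B * weight x₀ (𝓜.F x g) ^ (α * (γ + 1)) := hf _
    _ ≤ B * (𝓜.bigM x₀ g * weight x₀ x) ^ (α * (γ + 1)) := by
      gcongr
      exact 𝓜.weight_F_le_mul x₀ g x
    _ = B * weight x₀ x ^ (α * (γ + 1)) * 𝓜.bigM x₀ g ^ (α * (γ + 1)) := by
      rw [Real.mul_rpow hM.le hp.le]; ring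
    _ ≤ _ := by gcongr

lemma norm_sub_le_scaledΔ (h : 𝓜.Contracts x₀ α β Γ l κ) (hα : 0 < α) (hβ : 0 ≤ β) (hγ : 0 ≤ γ)
    (f : WHolder x₀ α β γ) (x y : E) :
    ‖f x - f y‖ ≤ ‖f‖ * l ^ (-(α * γ + α * β)) *
      (dist x y ^ α * scaledΔ x₀ l (α * γ) (α * β) x y) := by
  refine (WHolder.norm_sub_le f x y).trans ?_
  have h1 := weightΔ_le_mul_scaledΔ x₀ h.l_pos h.l_le_one (α := α) (β := β) (γ := γ)
    (by positivity) (by positivity) x y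
  have h2 := norm_nonneg f
  calc _ ≤ ‖f‖ * (dist x y ^ α * (l ^ (-(α * γ + α * β)) *
        scaledΔ x₀ l (α * γ) (α * β) x y)) := by gcongr
    _ = _ := by ring

lemma integrable_comp_F (h : 𝓜.Contracts x₀ α β Γ l κ) (hα : 0 < α) (hγ : 0 ≤ γ) (hγΓ : γ ≤ Γ)
    {B : ℝ} (hB : 0 ≤ B) {f : E → ℂ} (hfm : Measurable f)
    (hf : ∀ x, ‖f x‖ ≤ B * weight x₀ x ^ (α * (γ + 1))) (x : E) :
    Integrable (fun g => f (𝓜.F x g)) 𝓜.law :=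
  (h.integrable_bigM.const_mul (B * weight x₀ x ^ (α * (γ + 1)))).mono'
    (hfm.comp (𝓜.measurable_F_right x)).aestronglyMeasurable
    (Eventually.of_forall fun g => norm_comp_F_le hα hγ hγΓ hB hf x g)

lemma norm_integral_kernel_le (h : 𝓜.Contracts x₀ α β Γ l κ) (hα : 0 < α) (hγ : 0 ≤ γ)
    (hγΓ : γ ≤ Γ) {B : ℝ} (hB : 0 ≤ B) {f : E → ℂ} (hfm : Measurable f)
    (hf : ∀ x, ‖f x‖ ≤ B * weight x₀ x ^ (α * (γ + 1))) (x : E) :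
    ‖∫ y, f y ∂(𝓜.kernel x)‖ ≤
      B * weight x₀ x ^ (α * (γ + 1)) * ∫ g, 𝓜.bigM x₀ g ^ (α * (Γ + 1)) ∂𝓜.law := by
  rw [𝓜.integral_kernel hfm, ← integral_const_mul]
  exact norm_integral_le_of_norm_le (h.integrable_bigM.const_mul _)
    (Eventually.of_forall fun g => norm_comp_F_le hα hγ hγΓ hB hf x g)

/-- The transition kernel contracts the Hölder seminorm built on the weight `p_l`. -/
lemma norm_integral_kernel_sub_le (h : 𝓜.Contracts x₀ α β Γ l κ) (hα : 0 < α) (hβ : 0 ≤ β)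
    (hγ : 0 ≤ γ) (hγΓ : γ ≤ Γ) {A B : ℝ} (hA : 0 ≤ A) (hB : 0 ≤ B) {f : E → ℂ}
    (hfm : Measurable f) (hf : ∀ x, ‖f x‖ ≤ B * weight x₀ x ^ (α * (γ + 1)))
    (hfA : ∀ x y, ‖f x - f y‖ ≤ A * (dist x y ^ α * scaledΔ x₀ l (α * γ) (α * β) x y)) (x y : E) :
    ‖∫ z, f z ∂(𝓜.kernel x) - ∫ z, f z ∂(𝓜.kernel y)‖ ≤
      κ * A * (dist x y ^ α * scaledΔ x₀ l (α * γ) (α * β) x y) := by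
  have hΔ := scaledΔ_nonneg x₀ h.l_pos.le (α * γ) (α * β) x y
  have hpt : ∀ g, ‖f (𝓜.F x g) - f (𝓜.F y g)‖ ≤
      A * (dist x y ^ α * scaledΔ x₀ l (α * γ) (α * β) x y) *
        (𝓜.lipC g ^ α * 𝓜.growth x₀ l g ^ (α * (Γ + β))) := by
    intro g
    have hC := 𝓜.lipC_nonneg g
    have hg1 := 𝓜.one_le_growth x₀ h.l_pos.le g
    have hg : 0 < 𝓜.growth x₀ l g := by linarith
    have h1 : dist (𝓜.F x g) (𝓜.F y g) ^ α ≤ 𝓜.lipC g ^ α * dist x y ^ α := by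
      rw [← Real.mul_rpow hC dist_nonneg]
      exact Real.rpow_le_rpow dist_nonneg (𝓜.dist_F_le g x y) hα.le
    have h2 : scaledΔ x₀ l (α * γ) (α * β) (𝓜.F x g) (𝓜.F y g) ≤
        𝓜.growth x₀ l g ^ (α * (Γ + β)) * scaledΔ x₀ l (α * γ) (α * β) x y := by
      -- The growth factor is at least `1`, so its exponent may be raised from `α(γ+β)` to `α(Γ+β)`;
      -- this makes `κ` independent of `γ`.
      refine (𝓜.scaledΔ_F_le x₀ h.l_pos.le (by positivity) (by positivity) g x y).trans ?_
      gcongr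
      nlinarith
    calc _ ≤ A * (dist (𝓜.F x g) (𝓜.F y g) ^ α *
          scaledΔ x₀ l (α * γ) (α * β) (𝓜.F x g) (𝓜.F y g)) := hfA _ _
      _ ≤ A * ((𝓜.lipC g ^ α * dist x y ^ α) *
          (𝓜.growth x₀ l g ^ (α * (Γ + β)) * scaledΔ x₀ l (α * γ) (α * β) x y)) := by
        gcongr
        exact scaledΔ_nonneg x₀ h.l_pos.le _ _ _ _
      _ = _ := by ring
  rw [𝓜.integral_kernel hfm, 𝓜.integral_kernel hfm,
    ← integral_sub (h.integrable_comp_F hα hγ hγΓ hB hfm hf x)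
      (h.integrable_comp_F hα hγ hγΓ hB hfm hf y)]
  refine (norm_integral_le_of_norm_le (h.integrable_lipC.const_mul _)
    (Eventually.of_forall hpt)).trans ?_
  rw [integral_const_mul]
  calc _ ≤ A * (dist x y ^ α * scaledΔ x₀ l (α * γ) (α * β) x y) * κ := by
        gcongr
        exact h.integral_le
    _ = _ := by ring

variable [BorelSpace E]

/-- The operator `Q` on `𝓑_{α,β,γ}`. -/
lemma exists_kernelOp (h : 𝓜.Contracts x₀ α β Γ l κ) (hα : 0 < α) (hβ : 0 ≤ β) (hγ : 0 ≤ γ)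
    (hγΓ : γ ≤ Γ) :
    ∃ P : WHolder x₀ α β γ →L[ℂ] WHolder x₀ α β γ, ∀ f : WHolder x₀ α β γ, ∀ x,
      Integrable (WHolder.toFunL x₀ α β γ f) (𝓜.kernel x) ∧
        P f x = ∫ y, f y ∂(𝓜.kernel x) := by
  have hfm : ∀ f : WHolder x₀ α β γ, Measurable (WHolder.toFunL x₀ α β γ f) := fun f =>
    (WHolder.continuous hα f).measurable
  have hint : ∀ (f : WHolder x₀ α β γ) (x : E),
      Integrable (WHolder.toFunL x₀ α β γ f) (𝓜.kernel x) := fun f x =>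
    (𝓜.integrable_kernel_iff (hfm f) x).2
      (h.integrable_comp_F hα hγ hγΓ (norm_nonneg f) (hfm f) (WHolder.norm_apply_le f) x)
  let L : WHolder x₀ α β γ →ₗ[ℂ] (E → ℂ) :=
    { toFun := fun f x => ∫ y, f y ∂(𝓜.kernel x)
      map_add' := fun f f' => by
        funext x
        simp only [WHolder.add_apply]
        exact integral_add (hint f x) (hint f' x)
      map_smul' := fun c f => by
        funext x
        simp only [WHolder.smul_apply]
        exact integral_const_mul c _ }
  have hl := h.l_pos
  have hκ := h.κ_nonneg
  have hM0 : 0 ≤ ∫ g, 𝓜.bigM x₀ g ^ (α * (Γ + 1)) ∂𝓜.law :=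
    integral_nonneg fun g => Real.rpow_nonneg (zero_le_one.trans (𝓜.one_le_bigM x₀ g)) _
  obtain ⟨P, hP, -⟩ := WHolder.exists_clm (x₀ := x₀) (α := α) (β := β) (γ := γ)
    (A := κ * l ^ (-(α * γ + α * β))) (B := ∫ g, 𝓜.bigM x₀ g ^ (α * (Γ + 1)) ∂𝓜.law)
    (by positivity) hM0 L
    (fun f x y => by
      have hf := norm_nonneg f
      have h1 := h.norm_integral_kernel_sub_le hα hβ hγ hγΓ
        (A := ‖f‖ * l ^ (-(α * γ + α * β))) (by positivity) hf (hfm f) (WHolder.norm_apply_le f)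
        (h.norm_sub_le_scaledΔ hα hβ hγ f) x y
      have h2 := scaledΔ_le_weightΔ x₀ hl.le h.l_le_one (α := α) (β := β) (γ := γ)
        (by positivity) (by positivity) x y
      refine h1.trans ?_
      calc _ ≤ κ * (‖f‖ * l ^ (-(α * γ + α * β))) * (dist x y ^ α * weightΔ x₀ α β γ x y) := by
            gcongr
        _ = _ := by ring)
    (fun f x => by
      refine (h.norm_integral_kernel_le hα hγ hγΓ (norm_nonneg f) (hfm f)
        (WHolder.norm_apply_le f) x).trans (le_of_eq ?_)
      ring)
  exact ⟨P, fun f x => ⟨hint f x, hP f x⟩⟩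

variable [SecondCountableTopology E]

/-- Invariant probability measures have a moment of order `α(Γ+1)`. -/
lemma integrable_weight (h : 𝓜.Contracts x₀ α β Γ l κ) (hα : 0 < α) (hβ : 1 ≤ β) (hΓ : 0 ≤ Γ)
    {π : Measure E} [IsProbabilityMeasure π] (hπ : Kernel.Invariant 𝓜.kernel π) :
    Integrable (fun x => weight x₀ x ^ (α * (Γ + 1))) π := by
  set r := α * (Γ + 1) with hr
  have hr0 : 0 < r := by positivity
  have hM := 𝓜.measurable_bigM x₀
  have hC := 𝓜.measurable_lipC
  have hM1 := 𝓜.one_le_bigM x₀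
  have hC0 := 𝓜.lipC_nonneg
  have hMr : ∀ g, 0 ≤ 𝓜.bigM x₀ g ^ r := fun g =>
    Real.rpow_nonneg (zero_le_one.trans (hM1 g)) _
  have hCM : ∀ g, 𝓜.lipC g ≤ 𝓜.bigM x₀ g := fun g => by
    unfold bigM
    linarith [dist_nonneg (x := 𝓜.F x₀ g) (y := x₀)]
  -- Write `𝒞^r = 𝒞^α 𝒞^{αΓ}` and bound the second factor by a power of the growth factor, which
  -- dominates both `𝒞` and `1`.
  have hCr : ∫ g, 𝓜.lipC g ^ r ∂𝓜.law < 1 := by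
    refine lt_of_le_of_lt ?_ h.κ_lt_one
    refine le_trans (integral_mono_of_nonneg (Eventually.of_forall fun g =>
      Real.rpow_nonneg (hC0 g) _) h.integrable_lipC (Eventually.of_forall fun g => ?_))
      h.integral_le
    have hg1 := 𝓜.one_le_growth x₀ h.l_pos.le g
    have hgC : 𝓜.lipC g ≤ 𝓜.growth x₀ l g := by
      unfold growth
      have := mul_nonneg h.l_pos.le (dist_nonneg (x := 𝓜.F x₀ g) (y := x₀))
      linarith [le_max_left (𝓜.lipC g) 1]
    change 𝓜.lipC g ^ r ≤ 𝓜.lipC g ^ α * 𝓜.growth x₀ l g ^ (α * (Γ + β))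
    calc 𝓜.lipC g ^ r = 𝓜.lipC g ^ α * 𝓜.lipC g ^ (α * Γ) := by
          rw [← Real.rpow_add_of_nonneg (hC0 g) hα.le (by positivity)]; congr 1; rw [hr]; ring
      _ ≤ 𝓜.lipC g ^ α * 𝓜.growth x₀ l g ^ (α * Γ) := by
          have := hC0 g
          gcongr
      _ ≤ _ := by
          have := hC0 g
          gcongr
          linarith
  have hint2 : Integrable (fun g => 1 * (𝓜.lipC g + 𝓜.bigM x₀ g) ^ r) 𝓜.law := by
    refine (h.integrable_bigM.const_mul (2 ^ r)).mono'
      (measurable_const.mul ((hC.add hM).pow_const _)).aestronglyMeasurable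
      (Eventually.of_forall fun g => ?_)
    have h0 := hC0 g
    have h1 := hM1 g
    rw [one_mul, Real.norm_of_nonneg (Real.rpow_nonneg (by linarith) _),
      ← Real.mul_rpow zero_le_two (by linarith)]
    exact Real.rpow_le_rpow (by linarith) (by linarith [hCM g]) hr0.le
  have hlim := tendsto_integral_mul_add_rpow (μ := 𝓜.law) (w := fun _ => 1) measurable_const hC hM
    (fun _ => zero_le_one) hC0 (fun g => zero_le_one.trans (hM1 g)) hr0.le hint2
  simp only [one_mul] at hlim hint2
  -- Perturbing `𝒞` to `𝒞 + εℳ` keeps the moment of order `r` below `1`; this moment is the drift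
  -- factor `ρ`.
  obtain ⟨ε, hε, hε01⟩ := ((hlim.eventually (eventually_lt_nhds hCr)).and
    (Ioc_mem_nhdsGT one_pos)).exists
  have hε0 : 0 < ε := hε01.1
  have hεint : Integrable (fun g => (𝓜.lipC g + ε * 𝓜.bigM x₀ g) ^ r) 𝓜.law := by
    refine hint2.mono' ((hC.add (hM.const_mul ε)).pow_const _).aestronglyMeasurable
      (Eventually.of_forall fun g => ?_)
    have h0 := hC0 g
    have h1 : 0 ≤ 𝓜.bigM x₀ g := zero_le_one.trans (hM1 g)
    have h2 : ε * 𝓜.bigM x₀ g ≤ 𝓜.bigM x₀ g := mul_le_of_le_one_left h1 hε01.2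
    rw [Real.norm_of_nonneg (by positivity)]
    gcongr
  have hWm : Measurable fun x => weight x₀ x ^ r := (continuous_weight_rpow x₀ r).measurable
  have hW0 : ∀ x, 0 ≤ weight x₀ x ^ r := fun x => Real.rpow_nonneg (weight_pos x₀ x).le _
  set B := ε⁻¹ ^ r * ∫ g, 𝓜.bigM x₀ g ^ r ∂𝓜.law with hB
  set ρ := ∫ g, (𝓜.lipC g + ε * 𝓜.bigM x₀ g) ^ r ∂𝓜.law with hρ
  have hB0 : 0 ≤ B := mul_nonneg (by positivity) (integral_nonneg hMr)
  have hρ0 : 0 ≤ ρ := integral_nonneg fun g => Real.rpow_nonneg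
    (add_nonneg (hC0 g) (mul_nonneg hε0.le (zero_le_one.trans (hM1 g)))) _
  have hfin := lintegral_ne_top_of_drift hπ hWm hW0 hρ0 hε hB0 (fun x => by
    have hp := weight_pos x₀ x
    rw [kernel_apply, lintegral_map hWm.ennreal_ofReal (𝓜.measurable_F_right x)]
    have hpt : ∀ g, weight x₀ (𝓜.F x g) ^ r ≤ weight x₀ x ^ r *
        (𝓜.lipC g + ε * 𝓜.bigM x₀ g) ^ r + ε⁻¹ ^ r * 𝓜.bigM x₀ g ^ r := by
      intro g
      have h0 := hC0 g
      have h1 : 0 < 𝓜.bigM x₀ g := zero_lt_one.trans_le (hM1 g)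
      have hp' := weight_pos x₀ (𝓜.F x g)
      rw [← Real.mul_rpow hp.le (by positivity), ← Real.mul_rpow (by positivity) h1.le]
      -- Far from `x₀`, where `εp(x) ≥ 1`, the additive `ℳ` is at most `εℳ p(x)`. Near `x₀`,
      -- `p(F(x,g)) ≤ ℳ p(x)` is at most `ℳ/ε`, which produces the constant `B`.
      rcases le_total ε⁻¹ (weight x₀ x) with hx | hx
      · have h2 : weight x₀ (𝓜.F x g) ≤ weight x₀ x * (𝓜.lipC g + ε * 𝓜.bigM x₀ g) := by
          have h3 := 𝓜.weight_F_le_add x₀ g x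
          have h4 : 1 ≤ weight x₀ x * ε := by
            rw [inv_eq_one_div, div_le_iff₀ hε0] at hx; exact hx
          nlinarith
        have h5 : 0 ≤ (ε⁻¹ * 𝓜.bigM x₀ g) ^ r := by positivity
        linarith [Real.rpow_le_rpow hp'.le h2 hr0.le]
      · have h2 : weight x₀ (𝓜.F x g) ≤ ε⁻¹ * 𝓜.bigM x₀ g := by
          refine (𝓜.weight_F_le_mul x₀ g x).trans ?_
          rw [mul_comm]
          gcongr
        have h5 : 0 ≤ (weight x₀ x * (𝓜.lipC g + ε * 𝓜.bigM x₀ g)) ^ r := by positivity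
        linarith [Real.rpow_le_rpow hp'.le h2 hr0.le]
    have hI : Integrable (fun g => weight x₀ x ^ r * (𝓜.lipC g + ε * 𝓜.bigM x₀ g) ^ r +
        ε⁻¹ ^ r * 𝓜.bigM x₀ g ^ r) 𝓜.law :=
      (hεint.const_mul _).add (h.integrable_bigM.const_mul _)
    calc ∫⁻ g, ENNReal.ofReal (weight x₀ (𝓜.F x g) ^ r) ∂𝓜.law
        ≤ ∫⁻ g, ENNReal.ofReal (weight x₀ x ^ r * (𝓜.lipC g + ε * 𝓜.bigM x₀ g) ^ r +
          ε⁻¹ ^ r * 𝓜.bigM x₀ g ^ r) ∂𝓜.law :=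
          lintegral_mono fun g => ENNReal.ofReal_le_ofReal (hpt g)
      _ = ENNReal.ofReal (∫ g, (weight x₀ x ^ r * (𝓜.lipC g + ε * 𝓜.bigM x₀ g) ^ r +
          ε⁻¹ ^ r * 𝓜.bigM x₀ g ^ r) ∂𝓜.law) :=
          (ofReal_integral_eq_lintegral_ofReal hI (Eventually.of_forall fun g =>
            (hW0 _).trans (hpt g))).symm
      _ = _ := by
          rw [integral_add (hεint.const_mul _) (h.integrable_bigM.const_mul _),
            integral_const_mul, integral_const_mul, mul_comm (weight x₀ x ^ r)])
  refine ⟨hWm.aestronglyMeasurable, ?_⟩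
  rw [hasFiniteIntegral_iff_ofReal (Eventually.of_forall hW0)]
  exact lt_top_iff_ne_top.2 hfin

end Contracts

end LipschitzModel

/-! ### Action of a kernel on `𝕃¹` of an invariant measure -/

section InvariantL1

variable {E : Type*} [MeasurableSpace E] {Q : Kernel E E} {π : Measure E}

/-- Invariance says that `π` is the composition of `Q` with the constant kernel `π`, so the Fubini
theorem for compositions applies. -/
lemma integrable_of_invariant {F : Type*} [NormedAddCommGroup F] [NormedSpace ℝ F]
    (hπ : Kernel.Invariant Q π) {f : E → F} (hf : Integrable f π) :
    (∀ᵐ x ∂π, Integrable f (Q x)) ∧ Integrable (fun x => ∫ y, f y ∂(Q x)) π ∧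
      ∫ x, ∫ y, f y ∂(Q x) ∂π = ∫ x, f x ∂π := by
  have e : (Q ∘ₖ Kernel.const Unit π) () = π := by
    rw [← Measure.comp_eq_comp_const_apply]; exact hπ.def
  have hf' : Integrable f ((Q ∘ₖ Kernel.const Unit π) ()) := by rwa [e]
  refine ⟨by simpa using hf'.ae_of_comp, by simpa using hf'.integral_comp, ?_⟩
  have := Kernel.integral_comp hf'
  rw [e] at this
  simpa using this.symm

lemma integral_norm_integral_le (hπ : Kernel.Invariant Q π) {f : E → ℂ} (hf : Integrable f π) :
    ∫ x, ‖∫ y, f y ∂(Q x)‖ ∂π ≤ ∫ x, ‖f x‖ ∂π := by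
  obtain ⟨-, h2, -⟩ := integrable_of_invariant hπ hf
  obtain ⟨-, h5, h6⟩ := integrable_of_invariant hπ hf.norm
  rw [← h6]
  exact integral_mono h2.norm h5 fun x => norm_integral_le_integral_norm _

/-- This makes `Q` act on `π`-classes: changing `f` on a `π`-null set changes `Qf` only on a
`π`-null set. -/
lemma ae_kernel_of_ae (hπ : Kernel.Invariant Q π) {p : E → Prop} (h : ∀ᵐ x ∂π, p x) :
    ∀ᵐ x ∂π, ∀ᵐ y ∂(Q x), p y :=
  Measure.ae_ae_of_ae_comp (by rwa [hπ.def])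

/-- The operator `u ↦ Q(φu)` on `𝕃¹(π)`, for a bounded measurable function `φ`. -/
lemma exists_kernelMulOp (hπ : Kernel.Invariant Q π) {φ : E → ℂ} (hφ : Measurable φ) {c : ℝ}
    (hc : ∀ x, ‖φ x‖ ≤ c) :
    ∃ R : Lp ℂ 1 π →L[ℂ] Lp ℂ 1 π, ∀ u : Lp ℂ 1 π,
      R u =ᵐ[π] fun x => ∫ y, φ y * u y ∂(Q x) := by
  have hint : ∀ u : Lp ℂ 1 π, Integrable (fun y => φ y * u y) π := fun u =>
    (L1.integrable_coeFn u).bdd_mul hφ.aestronglyMeasurable (Eventually.of_forall hc)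
  have hint' : ∀ u : Lp ℂ 1 π, Integrable (fun x => ∫ y, φ y * u y ∂(Q x)) π := fun u =>
    (integrable_of_invariant hπ (hint u)).2.1
  let R₀ : Lp ℂ 1 π →ₗ[ℂ] Lp ℂ 1 π :=
    { toFun := fun u => (hint' u).toL1 _
      map_add' := fun u u' => by
        rw [← Integrable.toL1_add, Integrable.toL1_eq_toL1_iff]
        filter_upwards [ae_kernel_of_ae hπ (Lp.coeFn_add u u'),
          (integrable_of_invariant hπ (hint u)).1, (integrable_of_invariant hπ (hint u')).1]
          with x hx h1 h2
        rw [Pi.add_apply, ← integral_add h1 h2]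
        refine integral_congr_ae ?_
        filter_upwards [hx] with y hy
        rw [hy, Pi.add_apply, mul_add]
      map_smul' := fun a u => by
        rw [RingHom.id_apply, ← Integrable.toL1_smul', Integrable.toL1_eq_toL1_iff]
        filter_upwards [ae_kernel_of_ae hπ (Lp.coeFn_smul a u)] with x hx
        rw [Pi.smul_apply, smul_eq_mul, ← integral_const_mul]
        refine integral_congr_ae ?_
        filter_upwards [hx] with y hy
        rw [hy, Pi.smul_apply, smul_eq_mul]
        ring }
  refine ⟨R₀.mkContinuous c fun u => ?_, fun u => (hint' u).coeFn_toL1⟩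
  change ‖(hint' u).toL1 _‖ ≤ _
  rw [L1.norm_of_fun_eq_integral_norm, L1.norm_eq_integral_norm, ← integral_const_mul]
  refine (integral_norm_integral_le hπ (hint u)).trans
    (integral_mono (hint u).norm ((L1.integrable_coeFn u).norm.const_mul c) fun y => ?_)
  rw [norm_mul]
  exact mul_le_mul_of_nonneg_right (hc y) (norm_nonneg _)

end InvariantL1

/-! ### The spaces `𝓑_{α,β,γ}` under a measure with moments -/

/-- The constant functions, as elements of `𝓑_{α,β,γ}`. -/
lemma exists_const {E : Type u} [MetricSpace E] {x₀ : E} {α β γ : ℝ} (hα : 0 < α) (hγ : 0 ≤ γ) (c : ℂ) :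
    ∃ e : WHolder x₀ α β γ, ∀ x, e x = c := by
  refine ⟨WHolder.mk (A := 0) (B := ‖c‖) (fun _ => c) (fun x y => by simp) fun x => ?_,
    fun x => rfl⟩
  have h4 : 1 ≤ weight x₀ x ^ (α * (γ + 1)) :=
    Real.one_le_rpow (one_le_weight x₀ x) (by positivity)
  nlinarith [norm_nonneg c]

section Moments

variable {E : Type u} [MetricSpace E] {x₀ : E} [MeasurableSpace E]
  {α β γ γ' : ℝ} {π : Measure E}

/-- Write `f(x) - π(f)` as the mean of `f(x) - f(y)` and integrate the separated bound in `y`.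
Modulo constants, the Hölder seminorm thus controls the whole norm. -/
lemma norm_sub_integral_le [IsProbabilityMeasure π] (hα : 0 < α) (hβγ : β ≤ γ)
    (hint : Integrable (fun x => weight x₀ x ^ (α * (γ + 1))) π) {f : E → ℂ} (hf : Integrable f π)
    {A : ℝ} (hA : 0 ≤ A)
    (hfA : ∀ x y, ‖f x - f y‖ ≤ A * (dist x y ^ α * weightΔ x₀ α β γ x y)) (x : E) :
    ‖f x - ∫ y, f y ∂π‖ ≤
      A * (2 * ∫ y, weight x₀ y ^ (α * (γ + 1)) ∂π) * weight x₀ x ^ (α * (γ + 1)) := by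
  have e : f x - ∫ y, f y ∂π = ∫ y, (f x - f y) ∂π := by
    rw [integral_sub (integrable_const _) hf]
    simp
  rw [e]
  refine (norm_integral_le_of_norm_le (hint.const_mul (2 * A * weight x₀ x ^ (α * (γ + 1))))
    (Eventually.of_forall fun y => ?_)).trans (le_of_eq ?_)
  · refine (hfA x y).trans ?_
    calc _ ≤ A * (2 * (weight x₀ x ^ (α * (γ + 1)) * weight x₀ y ^ (α * (γ + 1)))) := by
          refine mul_le_mul_of_nonneg_left ?_ hA
          exact dist_rpow_mul_weightΔ_le x₀ hα hβγ x y
      _ = _ := by ring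
  · rw [integral_const_mul]; ring

/-- The weighted sup norm is recovered from the seminorm and `π(|f|)`; this is why the `𝕃¹(π)` norm
can serve as the auxiliary norm. -/
lemma norm_le_integral_add [IsProbabilityMeasure π] (hα : 0 < α) (hβγ : β ≤ γ)
    (hγ : 0 ≤ γ) (hint : Integrable (fun x => weight x₀ x ^ (α * (γ + 1))) π) {f : E → ℂ}
    (hf : Integrable f π) {A : ℝ} (hA : 0 ≤ A)
    (hfA : ∀ x y, ‖f x - f y‖ ≤ A * (dist x y ^ α * weightΔ x₀ α β γ x y)) (x : E) :
    ‖f x‖ ≤ (∫ y, ‖f y‖ ∂π + A * (2 * ∫ y, weight x₀ y ^ (α * (γ + 1)) ∂π)) *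
      weight x₀ x ^ (α * (γ + 1)) := by
  have h1 := norm_sub_integral_le hα hβγ hint hf hA hfA x
  have h2 : ‖∫ y, f y ∂π‖ ≤ ∫ y, ‖f y‖ ∂π := norm_integral_le_integral_norm _
  have h3 : ‖f x‖ ≤ ‖f x - ∫ y, f y ∂π‖ + ‖∫ y, f y ∂π‖ := by
    simpa using norm_add_le (f x - ∫ y, f y ∂π) (∫ y, f y ∂π)
  have h4 : 1 ≤ weight x₀ x ^ (α * (γ + 1)) :=
    Real.one_le_rpow (one_le_weight x₀ x) (by positivity)
  have h5 : 0 ≤ ∫ y, ‖f y‖ ∂π := integral_nonneg fun _ => norm_nonneg _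
  nlinarith

variable [BorelSpace E]

lemma integrable_weight_of_le [IsProbabilityMeasure π] (hα : 0 < α) (h : γ ≤ γ')
    (hint : Integrable (fun x => weight x₀ x ^ (α * (γ' + 1))) π) :
    Integrable (fun x => weight x₀ x ^ (α * (γ + 1))) π := by
  refine hint.mono' (continuous_weight_rpow x₀ _).aestronglyMeasurable
    (Eventually.of_forall fun x => ?_)
  have h1 := one_le_weight x₀ x
  rw [Real.norm_of_nonneg (by positivity)]
  gcongr

lemma WHolder.integrable (hα : 0 < α)
    (hint : Integrable (fun x => weight x₀ x ^ (α * (γ + 1))) π) (f : WHolder x₀ α β γ) :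
    Integrable (WHolder.toFunL x₀ α β γ f) π :=
  (hint.const_mul ‖f‖).mono' (WHolder.continuous hα f).measurable.aestronglyMeasurable
    (Eventually.of_forall (WHolder.norm_apply_le f))

lemma WHolder.integral_norm_le (hα : 0 < α)
    (hint : Integrable (fun x => weight x₀ x ^ (α * (γ + 1))) π) (f : WHolder x₀ α β γ) :
    ∫ x, ‖f x‖ ∂π ≤ (∫ x, weight x₀ x ^ (α * (γ + 1)) ∂π) * ‖f‖ := by
  rw [mul_comm, ← integral_const_mul]
  exact integral_mono (f.integrable hα hint).norm (hint.const_mul _) (WHolder.norm_apply_le f)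

lemma holderSpace_isAdmissible (hα : 0 < α) (hγ : 0 ≤ γ)
    (hint : Integrable (fun x => weight x₀ x ^ (α * (γ + 1))) π) :
    (holderSpace x₀ α β γ).IsAdmissible π where
  complete := WHolder.completeSpace
  measurable f := (WHolder.continuous hα f).measurable
  integrable f := WHolder.integrable hα hint f
  one_mem := by
    obtain ⟨e, he⟩ := exists_const (x₀ := x₀) (α := α) (β := β) (γ := γ) hα hγ 1
    exact ⟨e, funext he⟩
  embeds_L1 := ⟨_, WHolder.integral_norm_le hα hint⟩

/-- The canonical map `𝓑_{α,β,γ} → 𝕃¹(π)`. -/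
lemma exists_toL1 (hα : 0 < α)
    (hint : Integrable (fun x => weight x₀ x ^ (α * (γ + 1))) π) :
    ∃ J : WHolder x₀ α β γ →L[ℂ] Lp ℂ 1 π,
      ∀ f : WHolder x₀ α β γ, J f =ᵐ[π] WHolder.toFunL x₀ α β γ f := by
  let J₀ : WHolder x₀ α β γ →ₗ[ℂ] Lp ℂ 1 π :=
    { toFun := fun f => (f.integrable hα hint).toL1 _
      map_add' := fun f f' => by
        rw [← Integrable.toL1_add, Integrable.toL1_eq_toL1_iff, map_add]
      map_smul' := fun c f => by
        rw [RingHom.id_apply, ← Integrable.toL1_smul', Integrable.toL1_eq_toL1_iff, map_smul] }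
  refine ⟨J₀.mkContinuous (∫ x, weight x₀ x ^ (α * (γ + 1)) ∂π) fun f => ?_,
    fun f => (f.integrable hα hint).coeFn_toL1⟩
  change ‖(f.integrable hα hint).toL1 _‖ ≤ _
  rw [L1.norm_of_fun_eq_integral_norm]
  exact f.integral_norm_le hα hint

end Moments

/-- `Q(t)` is a contraction of `𝕃¹(π)`, because `|e^{i⟨t,ξ⟩}| = 1`; the auxiliary norm does not grow
under iteration. -/
lemma integral_norm_fourier_le {E : Type*} [MeasurableSpace E] {d : ℕ}
    {ξ : E → EuclideanSpace ℝ (Fin d)} {π : Measure E} {Q : Kernel E E} (hπ : Kernel.Invariant Q π)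
    {t : EuclideanSpace ℝ (Fin d)} (hξm : Measurable (phase ξ t)) {f : E → ℂ}
    (hf : Integrable f π) :
    ∫ x, ‖∫ y, phase ξ t y * f y ∂(Q x)‖ ∂π ≤ ∫ x, ‖f x‖ ∂π := by
  have h1 : Integrable (fun y => phase ξ t y * f y) π :=
    hf.bdd_mul hξm.aestronglyMeasurable (Eventually.of_forall fun y => (norm_phase t y).le)
  refine (integral_norm_integral_le hπ h1).trans (le_of_eq ?_)
  simp only [norm_mul, norm_phase, one_mul]

/-! ### Strong ergodicity, regularity of `Q(t)`, Doeblin-Fortet inequalities -/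

namespace LipschitzModel.Contracts

variable {E : Type u} [MetricSpace E] [MeasurableSpace E] {G : Type v} [MeasurableSpace G] {𝓜 : LipschitzModel E G} {x₀ : E}
  {α β γ γ' Γ l κ s K : ℝ} {π : Measure E} {d : ℕ}
  {ξ : E → EuclideanSpace ℝ (Fin d)}

lemma le_weightΔ_of_le_scaledΔ (h : 𝓜.Contracts x₀ α β Γ l κ) (hα : 0 < α) (hβ : 0 ≤ β)
    (hγ : 0 ≤ γ) {A : ℝ} (hA : 0 ≤ A) {f : E → ℂ}
    (hf : ∀ x y, ‖f x - f y‖ ≤ A * (dist x y ^ α * scaledΔ x₀ l (α * γ) (α * β) x y)) (x y : E) :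
    ‖f x - f y‖ ≤ A * (dist x y ^ α * weightΔ x₀ α β γ x y) := by
  refine (hf x y).trans (mul_le_mul_of_nonneg_left (mul_le_mul_of_nonneg_left ?_
    (by positivity)) hA)
  exact scaledΔ_le_weightΔ x₀ h.l_pos.le h.l_le_one (by positivity) (by positivity) x y

/-- `Q(t)` as an operator from `𝓑_{α,β,γ}` to `𝓑_{α,β,γ'}`, as the composition of `Q` with a
multiplication operator. -/
lemma isFourierOp_comp {P : WHolder x₀ α β γ' →L[ℂ] WHolder x₀ α β γ'}
    (hP : ∀ f : WHolder x₀ α β γ', ∀ x,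
      Integrable (WHolder.toFunL x₀ α β γ' f) (𝓜.kernel x) ∧ P f x = ∫ y, f y ∂(𝓜.kernel x))
    {t : EuclideanSpace ℝ (Fin d)} {T : WHolder x₀ α β γ →L[ℂ] WHolder x₀ α β γ'}
    (hT : ∀ f x, T f x = phase ξ t x * f x) :
    IsFourierOp 𝓜.kernel ξ t (holderSpace x₀ α β γ) (holderSpace x₀ α β γ') (P.comp T) := by
  intro f x
  have e : WHolder.toFunL x₀ α β γ' (T f) = twist ξ t (WHolder.toFunL x₀ α β γ f) :=
    funext fun y => hT f y
  obtain ⟨h1, h2⟩ := hP (T f) x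
  rw [e] at h1
  refine ⟨h1, h2.trans ?_⟩
  rw [e]
  rfl

variable [BorelSpace E] [IsProbabilityMeasure π]

/-- Strong ergodicity on `𝓑_{α,β,γ}`. -/
lemma stronglyErgodic (h : 𝓜.Contracts x₀ α β Γ l κ) (hα : 0 < α) (hβ : 0 ≤ β) (hβγ : β ≤ γ)
    (hγΓ : γ ≤ Γ) (hπ : Kernel.Invariant 𝓜.kernel π)
    (hint : Integrable (fun x => weight x₀ x ^ (α * (γ + 1))) π) :
    StronglyErgodic 𝓜.kernel π (holderSpace x₀ α β γ) := by
  have hγ : 0 ≤ γ := hβ.trans hβγ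
  obtain ⟨T, hT⟩ := h.exists_kernelOp (β := β) hα hβ hγ hγΓ
  obtain ⟨e, he⟩ := exists_const (x₀ := x₀) (α := α) (β := β) (γ := γ) hα hγ 1
  set I := ∫ y, weight x₀ y ^ (α * (γ + 1)) ∂π with hI
  have hI0 : 0 ≤ I := integral_nonneg fun y => Real.rpow_nonneg (weight_pos x₀ y).le _
  have hfi := fun f : WHolder x₀ α β γ => f.integrable hα hint
  let P₀ : WHolder x₀ α β γ →ₗ[ℂ] WHolder x₀ α β γ :=
    { toFun := fun f => (∫ y, f y ∂π) • e
      map_add' := fun f f' => by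
        simp only [WHolder.add_apply]
        rw [integral_add (hfi f) (hfi f'), add_smul]
      map_smul' := fun c f => by
        simp only [WHolder.smul_apply]
        rw [integral_const_mul, mul_smul, RingHom.id_apply] }
  let P : WHolder x₀ α β γ →L[ℂ] WHolder x₀ α β γ := P₀.mkContinuous (I * ‖e‖) fun f => by
    change ‖(∫ y, f y ∂π) • e‖ ≤ _
    rw [norm_smul]
    have h1 := (norm_integral_le_integral_norm (μ := π) _).trans (f.integral_norm_le hα hint)
    calc _ ≤ (I * ‖f‖) * ‖e‖ := mul_le_mul_of_nonneg_right h1 (norm_nonneg e)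
      _ = _ := by ring
  have hP : ∀ (f : WHolder x₀ α β γ) x, P f x = ∫ y, f y ∂π := fun f x => by
    change ((∫ y, f y ∂π) • e) x = _
    rw [WHolder.smul_apply, he, mul_one]
  set q := l ^ (-(α * γ + α * β)) with hq
  have hq0 : 0 < q := Real.rpow_pos_of_pos h.l_pos _
  have hκ := h.κ_nonneg
  -- The iteration stays in the `p_l` seminorm, so the comparison constant `q` is paid once and not
  -- at each step.
  have hTn : ∀ (n : ℕ) (f : WHolder x₀ α β γ),
      (∀ x y, ‖(T ^ n) f x - (T ^ n) f y‖ ≤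
        κ ^ n * (‖f‖ * q) * (dist x y ^ α * scaledΔ x₀ l (α * γ) (α * β) x y)) ∧
      ∫ x, (T ^ n) f x ∂π = ∫ x, f x ∂π := by
    intro n f
    have hf := norm_nonneg f
    induction n with
    | zero => exact ⟨fun x y => by
        rw [pow_zero κ, one_mul]; exact h.norm_sub_le_scaledΔ hα hβ hγ f x y, by simp⟩
    | succ n ih =>
      have hTs : ∀ x, (T ^ (n + 1)) f x = ∫ y, (T ^ n) f y ∂(𝓜.kernel x) := fun x => by
        rw [pow_succ', mul_apply_eq_comp]
        exact (hT _ x).2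
      simp only [hTs]
      refine ⟨fun x y => ?_, ?_⟩
      · refine (h.norm_integral_kernel_sub_le hα hβ hγ hγΓ (by positivity)
          (norm_nonneg ((T ^ n) f)) (WHolder.continuous hα _).measurable
          (WHolder.norm_apply_le _) ih.1 x y).trans (le_of_eq ?_)
        ring
      · rw [(integrable_of_invariant hπ (hfi _)).2.2]
        exact ih.2
  refine ⟨T, P, hT, hP, ?_⟩
  have hbound : ∀ n : ℕ, ‖T ^ n - P‖ ≤ κ ^ n * (q + q * (2 * I)) := by
    intro n
    refine ContinuousLinearMap.opNorm_le_bound _ (by positivity) fun f => ?_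
    have hf := norm_nonneg f
    obtain ⟨h1, h2⟩ := hTn n f
    have h3 := h.le_weightΔ_of_le_scaledΔ hα hβ hγ (by positivity) h1
    have e1 : ∀ x, (T ^ n - P) f x = (T ^ n) f x - ∫ y, f y ∂π := fun x => by
      rw [_root_.sub_apply, WHolder.sub_apply, hP]
    refine (WHolder.norm_le (A := κ ^ n * (‖f‖ * q)) (B := κ ^ n * (‖f‖ * q) * (2 * I))
      (by positivity) (by positivity) _ (fun x y => ?_) (fun x => ?_)).trans (le_of_eq (by ring))
    · rw [e1, e1, sub_sub_sub_cancel_right]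
      exact h3 x y
    -- Replacing `π(f)` by `π(Qⁿf)` makes this the deviation of `Qⁿf` from its own mean.
    · rw [e1, ← h2]
      exact norm_sub_integral_le hα hβγ hint (hfi _) (by positivity) h3 x
  have hlim := (tendsto_pow_atTop_nhds_zero_of_lt_one hκ h.κ_lt_one).mul_const
    (q + q * (2 * I))
  rw [zero_mul] at hlim
  exact squeeze_zero (fun n => norm_nonneg _) hbound hlim

/-- Regularity of `t ↦ Q(t)` from `𝓑_{α,β,γ}` to `𝓑_{α,β,γ'}`. -/
lemma fourierContDiff (h : 𝓜.Contracts x₀ α β Γ l κ) (hξ : PhaseBound x₀ α s K ξ) (hα : 0 < α)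
    (hα1 : α ≤ 1) (hs : 0 ≤ s) (hβ : s + 1 ≤ β) (hβγ : β ≤ γ) (hγ'Γ : γ' ≤ Γ) (n : ℕ)
    (hn : α * γ + n * (s + 1) < α * γ') :
    FourierContDiff 𝓜.kernel ξ n Set.univ (holderSpace x₀ α β γ) (holderSpace x₀ α β γ') := by
  have hn0 : 0 ≤ (n : ℝ) * (s + 1) := by positivity
  have hγγ' : γ ≤ γ' := le_of_mul_le_mul_left (a := α) (by linarith) hα
  obtain ⟨P, hP⟩ := h.exists_kernelOp (β := β) (γ := γ') hα (by linarith) (by linarith) hγ'Γ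
  choose T hT _ using fun t => (hξ.isSymbol_phase hα hα1 t).exists_mulOp (γ := γ) (γ' := γ')
    hα hβ hβγ (by nlinarith)
  -- Multiplication carries the whole loss from `γ` to `γ'`; composing on the left with the fixed
  -- operator `Q` on `𝓑_{α,β,γ'}` preserves smoothness.
  refine ⟨fun t => P.comp (T t), fun t _ => isFourierOp_comp hP (hT t), ?_⟩
  exact (((ContinuousLinearMap.compL ℂ (WHolder x₀ α β γ) (WHolder x₀ α β γ')
    (WHolder x₀ α β γ') P).restrictScalars ℝ).contDiff.comp
    (hξ.contDiff_mulOp hα hα1 hs hβ hβγ n hn T hT)).contDiffOn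

/-- One step of the Doeblin-Fortet inequality. -/
lemma norm_integral_phase_mul_sub_le (h : 𝓜.Contracts x₀ α β Γ l κ) (hξ : PhaseBound x₀ α s K ξ)
    (hα : 0 < α) (hα1 : α ≤ 1) (hs : 0 ≤ s) (hβ : s + 1 ≤ β) (hβγ : β ≤ γ) (hγΓ : γ ≤ Γ)
    (hint : Integrable (fun x => weight x₀ x ^ (α * (γ + 1))) π) (t : EuclideanSpace ℝ (Fin d))
    (hξm : Measurable (phase ξ t))
    (f : WHolder x₀ α β γ) {A : ℝ} (hA : 0 ≤ A)
    (hf : ∀ x y, ‖f x - f y‖ ≤ A * (dist x y ^ α * scaledΔ x₀ l (α * γ) (α * β) x y)) (x y : E) :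
    ‖∫ z, phase ξ t z * f z ∂(𝓜.kernel x) - ∫ z, phase ξ t z * f z ∂(𝓜.kernel y)‖ ≤
      κ * (A + 2 * K * ‖t‖ ^ α * l ^ (-(α * γ + α * β)) *
        (∫ z, ‖f z‖ ∂π + A * (2 * ∫ z, weight x₀ z ^ (α * (γ + 1)) ∂π))) *
        (dist x y ^ α * scaledΔ x₀ l (α * γ) (α * β) x y) := by
  have hβ0 : 0 ≤ β := by linarith
  have hγ : 0 ≤ γ := by linarith
  have hK := hξ.one_le
  have hl := h.l_pos
  set B := ∫ z, ‖f z‖ ∂π + A * (2 * ∫ z, weight x₀ z ^ (α * (γ + 1)) ∂π) with hB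
  have hI0 : 0 ≤ ∫ y, weight x₀ y ^ (α * (γ + 1)) ∂π :=
    integral_nonneg fun y => Real.rpow_nonneg (weight_pos x₀ y).le _
  have hB0 : 0 ≤ B :=
    add_nonneg (integral_nonneg fun _ => norm_nonneg _) (mul_nonneg hA (by positivity))
  have hfB : ∀ x, ‖f x‖ ≤ B * weight x₀ x ^ (α * (γ + 1)) :=
    norm_le_integral_add hα hβγ hγ hint (f.integrable hα hint) hA
      (h.le_weightΔ_of_le_scaledΔ hα hβ0 hγ hA hf)
  have hmain : ∀ x y, weight x₀ x ≤ weight x₀ y →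
      ‖phase ξ t x * f x - phase ξ t y * f y‖ ≤
      (A + 2 * K * ‖t‖ ^ α * l ^ (-(α * γ + α * β)) * B) *
        (dist x y ^ α * scaledΔ x₀ l (α * γ) (α * β) x y) := by
    intro x y hxy
    have e : phase ξ t x * f x - phase ξ t y * f y =
        f x * (phase ξ t x - phase ξ t y) + phase ξ t y * (f x - f y) := by ring
    -- Order `0`, so there is no change of exponent: the perturbation stays in `𝓑_{α,β,γ}` and is of
    -- size `|t|^α`.
    have h1 := norm_mul_norm_sub_le (γ' := γ) (by positivity) hB0 hα hβ hβγ (by linarith) hfB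
      (hξ.norm_phase_sub_le hα hα1 t) x y hxy
    have h2 := weightΔ_le_mul_scaledΔ x₀ h.l_pos h.l_le_one (α := α) (β := β) (γ := γ)
      (by positivity) (by positivity) x y
    have h3 : ‖f x‖ * ‖phase ξ t x - phase ξ t y‖ ≤ 2 * K * ‖t‖ ^ α * B *
        (dist x y ^ α * (l ^ (-(α * γ + α * β)) * scaledΔ x₀ l (α * γ) (α * β) x y)) :=
      h1.trans (by gcongr)
    rw [e]
    refine (norm_add_le _ _).trans ?_
    rw [norm_mul, norm_mul, norm_phase, one_mul]
    have h4 := hf x y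
    linarith
  have hmeas : Measurable fun z => phase ξ t z * f z :=
    hξm.mul (WHolder.continuous hα f).measurable
  refine (h.norm_integral_kernel_sub_le hα hβ0 hγ hγΓ (by positivity) hB0 hmeas
    (fun x => ?_) (fun x y => ?_) x y).trans le_rfl
  · rw [norm_mul, norm_phase, one_mul]
    exact hfB x
  · rcases le_total (weight x₀ x) (weight x₀ y) with hxy | hxy
    · exact hmain x y hxy
    · have := hmain y x hxy
      have e : scaledΔ x₀ l (α * γ) (α * β) y x = scaledΔ x₀ l (α * γ) (α * β) x y := by
        unfold scaledΔ; ring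
      rwa [norm_sub_rev, dist_comm, e] at this

/-- The Doeblin-Fortet inequalities for `Q(t)`, `t` close to `0`. -/
lemma doeblinFortet (h : 𝓜.Contracts x₀ α β Γ l κ) (hξ : PhaseBound x₀ α s K ξ)
    (hα : 0 < α) (hα1 : α ≤ 1) (hs : 0 ≤ s) (hβ : s + 1 ≤ β) (hβγ : β ≤ γ) (hγΓ : γ ≤ Γ)
    (hπ : Kernel.Invariant 𝓜.kernel π)
    (hint : Integrable (fun x => weight x₀ x ^ (α * (γ + 1))) π)
    (hξm : ∀ t, Measurable (phase ξ t))
    (U : EuclideanSpace ℝ (Fin d) → (WHolder x₀ α β γ →L[ℂ] WHolder x₀ α β γ))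
    (hU : ∀ t f x, U t f x = ∫ y, phase ξ t y * f y ∂(𝓜.kernel x)) :
    ∃ δ > 0, ∃ ρ c : ℝ, 0 ≤ ρ ∧ ρ < 1 ∧ 0 < c ∧ ∀ n : ℕ, 1 ≤ n → ∀ f : WHolder x₀ α β γ,
      ∀ t ∈ Metric.ball (0 : EuclideanSpace ℝ (Fin d)) δ,
        ‖(U t ^ n) f‖ ≤ c * ρ ^ n * ‖f‖ + c * ∫ x, ‖f x‖ ∂π := by
  have hβ0 : 0 ≤ β := by linarith
  have hγ : 0 ≤ γ := by linarith
  have hK := hξ.one_le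
  have hκ0 := h.κ_nonneg
  have hκ1 := h.κ_lt_one
  set q := l ^ (-(α * γ + α * β)) with hq
  have hq0 : 0 < q := Real.rpow_pos_of_pos h.l_pos _
  set I := ∫ z, weight x₀ z ^ (α * (γ + 1)) ∂π with hI
  have hI0 : 0 ≤ I := integral_nonneg fun y => Real.rpow_nonneg (weight_pos x₀ y).le _
  have hcont : ∀ C : ℝ, Tendsto (fun t : EuclideanSpace ℝ (Fin d) => C * ‖t‖ ^ α) (𝓝 0) (𝓝 0) := by
    intro C
    have hc : Continuous fun t : EuclideanSpace ℝ (Fin d) => C * ‖t‖ ^ α :=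
      continuous_const.mul (continuous_norm.rpow_const fun _ => Or.inr hα.le)
    simpa [Real.zero_rpow hα.ne'] using hc.tendsto 0
  -- Two smallness conditions on `t`: the factor of the seminorm must stay below `ρ = (1+κ)/2`, and
  -- that of `π(|f|)` below `1`.
  obtain ⟨δ, hδ, hball⟩ := Metric.eventually_nhds_iff_ball.1
    (((hcont (κ * (2 * K * q) * (2 * I))).eventually
      (eventually_lt_nhds (show (0 : ℝ) < (1 - κ) / 2 by linarith))).and
    ((hcont (κ * (2 * K * q))).eventually (eventually_lt_nhds one_pos)))
  set ρ := (1 + κ) / 2 with hρ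
  have hρ0 : 0 ≤ ρ := by rw [hρ]; linarith
  have hρ1 : ρ < 1 := by rw [hρ]; linarith
  have hρ1' : 0 < 1 - ρ := by linarith
  refine ⟨δ, hδ, ρ, (1 + 2 * I) * q + ((1 + 2 * I) / (1 - ρ) + 1), hρ0, hρ1, by positivity,
    fun n _ f t ht => ?_⟩
  obtain ⟨ht1, ht2⟩ := hball t ht
  set v := ∫ x, ‖f x‖ ∂π with hv
  have hv0 : 0 ≤ v := integral_nonneg fun _ => norm_nonneg _
  have hf0 := norm_nonneg f
  have hfi := fun f : WHolder x₀ α β γ => f.integrable hα hint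
  -- One step sends a seminorm bound `A` to `ρA + v`, whose fixed point is `v/(1-ρ)`; the excess
  -- over it decays like `ρⁿ`.
  have key : ∀ n : ℕ, (∀ x y, ‖(U t ^ n) f x - (U t ^ n) f y‖ ≤
      (ρ ^ n * (‖f‖ * q) + v / (1 - ρ)) *
        (dist x y ^ α * scaledΔ x₀ l (α * γ) (α * β) x y)) ∧
      ∫ x, ‖(U t ^ n) f x‖ ∂π ≤ v := by
    intro n
    induction n with
    | zero =>
      refine ⟨fun x y => ?_, by simp [hv]⟩
      have h1 := h.norm_sub_le_scaledΔ hα hβ0 hγ f x y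
      have h2 := scaledΔ_nonneg x₀ h.l_pos.le (α * γ) (α * β) x y
      simp only [pow_zero, one_apply_eq_self, one_mul]
      refine h1.trans (mul_le_mul_of_nonneg_right ?_ (by positivity))
      have : 0 ≤ v / (1 - ρ) := by positivity
      linarith
    | succ n ih =>
      obtain ⟨ih1, ih2⟩ := ih
      have hUs : ∀ x, (U t ^ (n + 1)) f x =
          ∫ y, phase ξ t y * (U t ^ n) f y ∂(𝓜.kernel x) := fun x => by
        rw [pow_succ', mul_apply_eq_comp, hU]
      simp only [hUs]
      refine ⟨fun x y => ?_, (integral_norm_fourier_le hπ (hξm t) (hfi _)).trans ih2⟩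
      have hA : 0 ≤ ρ ^ n * (‖f‖ * q) + v / (1 - ρ) := by positivity
      have hΔ := scaledΔ_nonneg x₀ h.l_pos.le (α * γ) (α * β) x y
      refine (h.norm_integral_phase_mul_sub_le hξ hα hα1 hs hβ hβγ hγΓ hint t (hξm t) _ hA ih1
        x y).trans (mul_le_mul_of_nonneg_right ?_ (by positivity))
      set A := ρ ^ n * (‖f‖ * q) + v / (1 - ρ) with hAdef
      have hD : 0 ≤ 2 * K * ‖t‖ ^ α * q := by positivity
      have e1 : ρ ^ (n + 1) * (‖f‖ * q) + v / (1 - ρ) = ρ * A + v := by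
        rw [hAdef]; field_simp; ring
      rw [e1]
      calc κ * (A + 2 * K * ‖t‖ ^ α * q * (∫ z, ‖(U t ^ n) f z‖ ∂π + A * (2 * I)))
          ≤ κ * (A + 2 * K * ‖t‖ ^ α * q * (v + A * (2 * I))) := by gcongr
        _ = (κ + κ * (2 * K * q) * (2 * I) * ‖t‖ ^ α) * A + κ * (2 * K * q) * ‖t‖ ^ α * v := by
          ring
        _ ≤ ρ * A + 1 * v := by
          gcongr
          rw [hρ]; linarith
        _ = _ := by ring
  obtain ⟨k1, k2⟩ := key n
  set A := ρ ^ n * (‖f‖ * q) + v / (1 - ρ) with hAdef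
  have hA : 0 ≤ A := by positivity
  have k3 := h.le_weightΔ_of_le_scaledΔ hα hβ0 hγ hA k1
  have k4 := norm_le_integral_add hα hβγ hγ hint (hfi _) hA k3
  have k5 : ‖(U t ^ n) f‖ ≤ A + (v + A * (2 * I)) := by
    refine WHolder.norm_le hA (by positivity) _ k3 fun x => (k4 x).trans ?_
    have := weight_pos x₀ x
    gcongr
  refine k5.trans ?_
  have e1 : A + (v + A * (2 * I)) =
      (1 + 2 * I) * q * ρ ^ n * ‖f‖ + ((1 + 2 * I) / (1 - ρ) + 1) * v := by
    rw [hAdef]; field_simp; ring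
  rw [e1]
  have : 0 ≤ (1 + 2 * I) / (1 - ρ) + 1 := by positivity
  have h1 : 0 ≤ ((1 + 2 * I) / (1 - ρ) + 1) * ρ ^ n * ‖f‖ := by positivity
  have h2 : 0 ≤ (1 + 2 * I) * q * v := by positivity
  nlinarith

end LipschitzModel.Contracts

/-! ### Continuity of `ξ`, action on `𝕃¹(π)`, condition (K) -/

lemma ConditionL.continuous {E : Type u} [MetricSpace E] {d : ℕ} {x₀ : E}
    {ξ : E → EuclideanSpace ℝ (Fin d)} {S s : ℝ} (hL : ConditionL x₀ ξ S s) (hs : 0 ≤ s) :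
    Continuous ξ := by
  rw [continuous_iff_continuousAt]
  intro y
  rw [ContinuousAt, tendsto_iff_norm_sub_tendsto_zero]
  have hc : Continuous fun x => S * dist x y * (1 + dist x x₀ + dist y x₀) ^ s := by
    have h1 : Continuous fun x => (1 + dist x x₀ + dist y x₀) ^ s :=
      (by fun_prop : Continuous fun x => 1 + dist x x₀ + dist y x₀).rpow_const
        fun _ => Or.inr hs
    fun_prop
  have ht := hc.tendsto y
  simp only [dist_self, mul_zero, zero_mul] at ht
  exact squeeze_zero (fun x => norm_nonneg _) (fun x => hL x y) ht

lemma continuous_phase {E : Type u} [TopologicalSpace E] {d : ℕ}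
    {ξ : E → EuclideanSpace ℝ (Fin d)} (hξ : Continuous ξ) (t : EuclideanSpace ℝ (Fin d)) :
    Continuous (phase ξ t) := by
  unfold phase
  fun_prop

/-- The operators `Q(t)` on `𝕃¹(π)`, and their continuity in `t` from `𝓑_{α,β,γ}` to `𝕃¹(π)`. -/
lemma exists_fourierOpL1 {E : Type u} [MetricSpace E] [MeasurableSpace E] [BorelSpace E] {d : ℕ}
    {ξ : E → EuclideanSpace ℝ (Fin d)} {x₀ : E} {α β γ : ℝ} {Q : Kernel E E} {π : Measure E}
    (hint : Integrable (fun x => weight x₀ x ^ (α * (γ + 1))) π) (hπ : Kernel.Invariant Q π)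
    (hξ : Continuous ξ) (J : WHolder x₀ α β γ →L[ℂ] Lp ℂ 1 π)
    (hJ : ∀ f : WHolder x₀ α β γ, J f =ᵐ[π] WHolder.toFunL x₀ α β γ f) :
    ∃ R : EuclideanSpace ℝ (Fin d) → (Lp ℂ 1 π →L[ℂ] Lp ℂ 1 π),
      (∀ t, IsFourierOpL1 Q ξ π t (R t)) ∧
      ∀ t, Tendsto (fun h => ‖(R (t + h)).comp J - (R t).comp J‖) (𝓝 0) (𝓝 0) := by
  have hm := fun t => (continuous_phase hξ t).measurable
  choose R hR using fun t => exists_kernelMulOp hπ (hm t) fun x => (norm_phase (ξ := ξ) t x).le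
  refine ⟨R, hR, fun t => ?_⟩
  have hdom : ∀ h y, ‖phase ξ (t + h) y - phase ξ t y‖ * weight x₀ y ^ (α * (γ + 1)) ≤
      2 * weight x₀ y ^ (α * (γ + 1)) := fun h y => by
    have hp := weight_pos x₀ y
    have h1 := norm_sub_le (phase ξ (t + h) y) (phase ξ t y)
    rw [norm_phase, norm_phase] at h1
    gcongr
    linarith
  have hmeas : ∀ h, AEStronglyMeasurable
      (fun y => ‖phase ξ (t + h) y - phase ξ t y‖ * weight x₀ y ^ (α * (γ + 1))) π := fun h =>
    (((continuous_phase hξ _).sub (continuous_phase hξ _)).norm.mul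
      (continuous_weight_rpow x₀ _)).measurable.aestronglyMeasurable
  have hdn : ∀ h y, ‖‖phase ξ (t + h) y - phase ξ t y‖ * weight x₀ y ^ (α * (γ + 1))‖ ≤
      2 * weight x₀ y ^ (α * (γ + 1)) := fun h y => by
    have hp := weight_pos x₀ y
    rw [Real.norm_of_nonneg (by positivity)]
    exact hdom h y
  have hψi : ∀ h, Integrable
      (fun y => ‖phase ξ (t + h) y - phase ξ t y‖ * weight x₀ y ^ (α * (γ + 1))) π := fun h =>
    (hint.const_mul 2).mono' (hmeas h) (Eventually.of_forall (hdn h))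
  -- This integral bounds the operator norm from `𝓑_{α,β,γ}` to `𝕃¹(π)`, since `|f| ≤ ‖f‖
  -- p^{α(γ+1)}` uniformly over `f`. The moment of `π` gives the domination.
  have hlim : Tendsto (fun h => ∫ y, ‖phase ξ (t + h) y - phase ξ t y‖ *
      weight x₀ y ^ (α * (γ + 1)) ∂π) (𝓝 0) (𝓝 0) := by
    have := tendsto_integral_filter_of_dominated_convergence (μ := π)
      (l := 𝓝 (0 : EuclideanSpace ℝ (Fin d)))
      (F := fun h y => ‖phase ξ (t + h) y - phase ξ t y‖ * weight x₀ y ^ (α * (γ + 1)))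
      (f := fun _ => 0) (fun y => 2 * weight x₀ y ^ (α * (γ + 1)))
      (Eventually.of_forall hmeas)
      (Eventually.of_forall fun h => Eventually.of_forall (hdn h))
      (hint.const_mul 2) (Eventually.of_forall fun y => ?_)
    · simpa using this
    · have hc : Continuous fun h : EuclideanSpace ℝ (Fin d) =>
          ‖phase ξ (t + h) y - phase ξ t y‖ * weight x₀ y ^ (α * (γ + 1)) := by
        unfold phase
        fun_prop
      simpa using hc.tendsto 0
  refine squeeze_zero (fun _ => norm_nonneg _) (fun h => ?_) hlim
  refine ContinuousLinearMap.opNorm_le_bound _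
    (integral_nonneg fun y => mul_nonneg (norm_nonneg _)
      (Real.rpow_nonneg (weight_pos x₀ y).le _)) fun f => ?_
  have hi : ∀ t, Integrable (fun y => phase ξ t y * J f y) π := fun t =>
    (L1.integrable_coeFn (J f)).bdd_mul (hm t).aestronglyMeasurable
      (Eventually.of_forall fun y => (norm_phase t y).le)
  have hdi : Integrable (fun y => phase ξ (t + h) y * J f y - phase ξ t y * J f y) π :=
    (hi _).sub (hi _)
  have hae : ((R (t + h)).comp J - (R t).comp J) f =ᵐ[π] fun x =>
      ∫ y, (phase ξ (t + h) y * J f y - phase ξ t y * J f y) ∂(Q x) := by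
    filter_upwards [Lp.coeFn_sub (R (t + h) (J f)) (R t (J f)), hR (t + h) (J f), hR t (J f),
      (integrable_of_invariant hπ (hi (t + h))).1, (integrable_of_invariant hπ (hi t)).1]
      with x h1 h2 h3 h4 h5
    rw [integral_sub h4 h5, ← h2, ← h3]
    exact h1
  rw [L1.norm_eq_integral_norm]
  refine (integral_congr_ae (hae.fun_comp fun z => ‖z‖)).le.trans ?_
  refine (integral_norm_integral_le hπ hdi).trans ?_
  rw [← integral_mul_const]
  refine integral_mono_ae hdi.norm ((hψi h).mul_const _) ?_
  filter_upwards [hJ f] with y hy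
  rw [hy, ← sub_mul, norm_mul, mul_assoc, mul_comm (weight x₀ y ^ _)]
  exact mul_le_mul_of_nonneg_left (WHolder.norm_apply_le f y) (norm_nonneg _)

/-- Condition (K) on `𝓑_{α,β,γ}`. -/
lemma LipschitzModel.Contracts.conditionK {E : Type u} [MetricSpace E] [MeasurableSpace E]
    [BorelSpace E] {G : Type v} [MeasurableSpace G]
    {𝓜 : LipschitzModel E G} {x₀ : E} {α β γ Γ l κ s K : ℝ} {π : Measure E}
    [IsProbabilityMeasure π] {d : ℕ} {ξ : E → EuclideanSpace ℝ (Fin d)}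
    (h : 𝓜.Contracts x₀ α β Γ l κ) (hξ : PhaseBound x₀ α s K ξ) (hξc : Continuous ξ)
    (hα : 0 < α) (hα1 : α ≤ 1) (hs : 0 ≤ s) (hβ : s + 1 ≤ β) (hβγ : β ≤ γ) (hγΓ : γ ≤ Γ)
    (hπ : Kernel.Invariant 𝓜.kernel π)
    (hint : Integrable (fun x => weight x₀ x ^ (α * (γ + 1))) π) :
    ConditionK 𝓜.kernel ξ π (holderSpace x₀ α β γ) := by
  refine ⟨h.stronglyErgodic hα (by linarith) hβγ hγΓ hπ hint, ?_⟩
  obtain ⟨P, hP⟩ := h.exists_kernelOp (β := β) (γ := γ) hα (by linarith) (by linarith) hγΓ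
  choose T hT _ using fun t => (hξ.isSymbol_phase hα hα1 t).exists_mulOp (γ := γ) (γ' := γ)
    hα hβ hβγ (by linarith)
  obtain ⟨J, hJ⟩ := exists_toL1 (β := β) hα hint
  obtain ⟨R, hR, hRc⟩ := exists_fourierOpL1 hint hπ hξc J hJ
  have hU : ∀ t, IsFourierOp 𝓜.kernel ξ t (holderSpace x₀ α β γ) (holderSpace x₀ α β γ)
      (P.comp (T t)) := fun t => isFourierOp_comp hP (hT t)
  obtain ⟨δ, hδ, ρ, c, hρ0, hρ1, hc, hDF⟩ := h.doeblinFortet hξ hα hα1 hs hβ hβγ hγΓ hπ hint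
    (fun t => (continuous_phase hξc t).measurable) (fun t => P.comp (T t))
    (fun t f x => (hU t f x).2)
  exact ⟨Metric.ball 0 δ, fun t => P.comp (T t), R, J, Metric.isOpen_ball,
    Metric.mem_ball_self hδ, fun t _ => hU t, fun t _ => hR t, hJ, fun t _ => hRc t,
    ρ, c, hρ0, hρ1, hc, hDF⟩

end SpectralMarkov

end

/-! ### The scale of spaces and the two translations -/

open SpectralMarkov
theorem proposition11p7
    {E : Type*} [MetricSpace E] [ProperSpace E] [NoncompactSpace E]
    [MeasurableSpace E] [BorelSpace E]
    {G : Type*} [MeasurableSpace G]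
    (𝓜 : LipschitzModel E G) (x₀ : E)
    (π : Measure E) [IsProbabilityMeasure π] (hπ : Kernel.Invariant 𝓜.kernel π)
    {d : ℕ} (ξ : E → EuclideanSpace ℝ (Fin d))
    (S s : ℝ) (hS : 0 ≤ S) (hs : 0 ≤ s) (hL : ConditionL x₀ ξ S s)
    (m : ℕ) (hm : 1 ≤ m)
    (α β γ γ' : ℝ) (hα : 0 < α) (hα1 : α ≤ 1)
    (hβ : s + 1 ≤ β) (hβγ : β ≤ γ) (hγ' : γ + m * (s + 1) / α < γ')
    (hmoment : ∫⁻ g, ENNReal.ofReal (𝓜.bigM x₀ g ^ (α * (γ' + 1)) +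
      𝓜.lipC g ^ α * 𝓜.bigM x₀ g ^ (α * (γ' + β))) ∂𝓜.law < ⊤)
    (hcontr : ∫⁻ g, ENNReal.ofReal (𝓜.lipC g ^ α *
      max (𝓜.lipC g) 1 ^ (α * (γ' + β))) ∂𝓜.law < 1) :
    HypothesisC m 𝓜.kernel ξ π (holderSpace x₀ α β γ) (holderSpace x₀ α β γ') := by
  have hmα : 0 ≤ m * (s + 1) / α := by positivity
  have hγγ' : γ < γ' := by linarith
  have hγ0 : 0 ≤ γ := by linarith
  obtain ⟨l, κ, h⟩ := 𝓜.exists_contracts hα (by linarith) (by linarith) hmoment hcontr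
  obtain ⟨K, hξ⟩ := hL.exists_phaseBound hS hs hα hα1
  have hξc := hL.continuous hs
  have hint' := h.integrable_weight hα (by linarith) (by linarith) hπ
  have hint : ∀ θ ∈ Set.Icc γ γ', Integrable (fun x => weight x₀ x ^ (α * (θ + 1))) π :=
    fun θ hθ => integrable_weight_of_le hα hθ.2 hint'
  -- The path `(T₀T₁)^m T₀` contains `m+1` copies of `T₀` and `m` of `T₁`, each with one `ε`; this
  -- `ε` makes it end exactly at `γ'`.
  set ε := (γ' - (γ + m * (s + 1) / α)) / (2 * m + 1) with hε
  have hε0 : 0 < ε := div_pos (by linarith) (by positivity)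
  have hεm : (2 * m + 1) * ε = γ' - γ - m * ((s + 1) / α) := by
    rw [hε]; field_simp; ring
  set σ := (s + 1) / α with hσ
  have hσ0 : 0 < σ := by positivity
  have hασ : α * σ = s + 1 := by rw [hσ]; field_simp
  have hiter : ∀ (k : ℕ) (θ : ℝ), ((fun θ => θ + ε) ∘ fun θ => θ + σ + ε)^[k] θ =
      θ + k * (σ + 2 * ε) := by
    intro k
    induction k with
    | zero => intro θ; simp
    | succ k ih =>
      intro θ
      rw [Function.iterate_succ_apply, ih]
      simp only [Function.comp_apply]
      push_cast
      ring
  -- Translations commute, so the orbits under `T₁T₀` need no separate computation.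
  have hcomm : ((fun θ => θ + σ + ε) ∘ fun θ => θ + ε) = (fun θ => θ + ε) ∘ fun θ => θ + σ + ε := by
    funext θ
    simp only [Function.comp_apply]
    ring
  refine ⟨Set.Icc γ γ', fun θ => holderSpace x₀ α β θ, fun θ => θ + ε, fun θ => θ + σ + ε,
    fun θ hθ => holderSpace_isAdmissible hα (hγ0.trans hθ.1) (hint θ hθ),
    fun θ hθ => holderSpace_embeds hα hβ (hβγ.trans hθ.1) hθ.2,
    fun θ hθ => ⟨fun _ => holderSpace_embeds hα hβ (hβγ.trans hθ.1) (by linarith),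
      fun _ => holderSpace_embeds hα hβ (hβγ.trans hθ.1) (by linarith),
      ⟨Set.univ, isOpen_univ, Set.mem_univ _, fun hT => ?_, fun j hj1 _ hT => ?_⟩,
      h.conditionK hξ hξc hα hα1 hs hβ (hβγ.trans hθ.1) hθ.2 hπ (hint θ hθ)⟩,
    γ, fun k hk => ?_, rfl, ?_⟩
  · exact h.fourierContDiff hξ hα hα1 hs hβ (hβγ.trans hθ.1) hT.2 0 (by
      push_cast
      have := mul_pos hα hε0
      linarith)
  · refine h.fourierContDiff hξ hα hα1 hs hβ (hβγ.trans hθ.1) hT.2 j ?_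
    rw [hiter, Nat.cast_sub hj1]
    have hj : (1 : ℝ) ≤ j := by exact_mod_cast hj1
    -- `θ_j` lies `jσ + (2j-1)ε` above `θ`: enough for `j` derivatives, with strict slack `(2j-1)ε >
    -- 0` because `j ≥ 1`.
    have e : α * (θ + ((j : ℝ) - (1 : ℕ)) * (σ + 2 * ε) + σ + ε) =
        α * θ + j * (α * σ) + α * ε * (2 * j - 1) := by push_cast; ring
    rw [e, hασ]
    have : 0 < α * ε * (2 * j - 1) := mul_pos (mul_pos hα hε0) (by linarith)
    linarith
  · have hk' : (k : ℝ) * (σ + 2 * ε) ≤ m * (σ + 2 * ε) := by gcongr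
    have hk0 : 0 ≤ (k : ℝ) * (σ + 2 * ε) := by positivity
    rw [hcomm, hiter, hiter]
    refine ⟨⟨by linarith, by linarith⟩, ⟨by linarith, by linarith⟩⟩
  · change holderSpace x₀ α β _ = _
    rw [hiter]
    congr 1
    linarith
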